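/- Let $(X,\mathcal B,\mu)$ be a non-atomic standard Borel probability space, $T:X\to X$ an ergodic automorphism and $f\in L^2(X,\mathcal B,\mu)$ a roof function with $f\ge c$ for some $c>0$. For $n\in\mathbb Z$ let $f^{(n)}=\sum_{k=0}^{n-1}f\circ T^k$ if $n\ge 0$ and $f^{(n)}=-\sum_{k=1}^{-n}f\circ T^{-k}$ if $n<0$. Let $T^f=(T^f_t)_{t\in\mathbb R}$ be the special flow on $X^f=\{(x,r):0\le r<f(x)\}$, $T^f_t(x,r)=(T^nx,\,r+t-f^{(n)}(x))$ with $n$ the unique integer such that $f^{(n)}(x)\le r+t<f^{(n+1)}(x)$, and let $\mu^f$ be the restriction of $\mu\otimes\mathrm{Leb}$ to $X^f$, normalized to a probability measure. Let $J_3(T^f)$ be the set of 3-self-joinings of $T^f$, i.e. of probability measures on $(X^f)^3$ that are invariant under $T^f_t\times T^f_t\times T^f_t$ for all $t$ and project to $\mu^f$ on each coordinate; $\lambda_n\to\lambda$ in $J_3(T^f)$ means $\lambda_n(A\times B\times C)\to\lambda(A\times B\times C)$ for all measurable $A,B,C\subset X^f$. For $t,u\in\mathbb R$ let $\mu^f_{t,u}\in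 J_3(T^f)$ be the image of $\mu^f$ under $y\mapsto(T^f_ty,T^f_uy,y)$. Let $W_n\subset X$ be measurable sets, $(q_n),(q_n')$ increasing sequences of natural numbers, $(a_n),(a_n')$ real sequences, $0<\alpha\le1$, $P$ a Borel probability measure on $\mathbb R^2$, and put $f_n=f^{(q_n)}-a_n$, $f_n'=f^{(q_n')}-a_n'$. Suppose that 1. $\mu(W_n)\to\alpha$; 2. $\mu(W_n\triangle T^{-1}W_n)\to0$; 3. $\mu\big((T^{-q_n}A\triangle A)\cap W_n\big)\to0$ for every $A\in\mathcal B$; 4. $\mu\big((T^{-q_n'}A\triangle A)\cap W_n\big)\to0$ for every $A\in\mathcal B$; 5. the sequence $\int_{W_n}|f_n|^2\,d\mu$ is bounded; 6. the sequence $\int_{W_n}|f_n'|^2\,d\mu$ is bounded; 7. $(f_n',f_n)_*(\mu(\,\cdot\,|W_n))\to P$ weakly. Then, up to passing to a subsequence, $\mu^f_{a_n',a_n}$ converges in $J_3(T^f)$ to $$\alpha\int_{\mathbb R^2}\mu^f_{-t,-u}\,dP(t,u)+(1-\alpha)\nu\qquad\text{for some }\nu\in J_3(T^f).$$ That is: every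 subsequence of $(\mu^f_{a_n',a_n})_n$ has a further subsequence that converges in $J_3(T^f)$ to a measure of this form, and whenever $(\mu^f_{a_n',a_n})_n$ or a subsequence of it converges in $J_3(T^f)$, its limit is of this form ($\nu$ may depend on the subsequence). If $\alpha=1$, the whole sequence converges to $\int_{\mathbb R^2}\mu^f_{-t,-u}\,dP(t,u)$. -/

import Mathlib

open MeasureTheory Set Filter Topology
open scoped BoundedContinuousFunction

noncomputable section

/-! ### Birkhoff sums over an automorphism -/

/-- The power `T ^ n`, `n ∈ ℤ`, of an automorphism `T`. -/
def iter {X : Type*} [MeasurableSpace X] (T : X ≃ᵐ X) (n : ℤ) (x : X) : X :=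
  ((T.toEquiv : Equiv.Perm X) ^ n) x

/-- The sums `f⁽ⁿ⁾`, `n ∈ ℤ`: `f(x) + f(Tx) + ⋯ + f(Tⁿ⁻¹x)` for `n ≥ 0` (so `0` for `n = 0`), and
`-(f(T⁻¹x) + ⋯ + f(Tⁿx))` for `n < 0`. -/
def cocycle {X : Type*} [MeasurableSpace X] (T : X ≃ᵐ X) (f : X → ℝ) (n : ℤ) (x : X) : ℝ :=
  if 0 ≤ n then ∑ k ∈ Finset.range n.toNat, f (iter T k x)
  else -∑ k ∈ Finset.range (-n).toNat, f (iter T (-(k + 1 : ℤ)) x)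

theorem cocycle_succ {X : Type*} [MeasurableSpace X] (T : X ≃ᵐ X) (f : X → ℝ) (n : ℤ) (x : X) :
    cocycle T f (n + 1) x = cocycle T f n x + f (iter T n x) := by
  rcases le_or_gt 0 n with h | h
  · obtain ⟨m, rfl⟩ := Int.eq_ofNat_of_zero_le h
    have h1 : ((m : ℤ) + 1).toNat = m + 1 := by omega
    have h0 : (0 : ℤ) ≤ (m : ℤ) + 1 := by omega
    simp only [cocycle, h, h0, if_true, h1, Int.toNat_natCast, Finset.sum_range_succ]
  · obtain ⟨m, rfl⟩ : ∃ m : ℕ, n = -((m : ℤ) + 1) := ⟨(-n - 1).toNat, by omega⟩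
    have h1 : (-(-((m : ℤ) + 1))).toNat = m + 1 := by omega
    have h2 : ¬ (0 : ℤ) ≤ -((m : ℤ) + 1) := by omega
    have e : cocycle T f (-((m : ℤ) + 1)) x =
        -(∑ k ∈ Finset.range m, f (iter T (-(k + 1 : ℤ)) x) + f (iter T (-((m : ℤ) + 1)) x)) := by
      simp only [cocycle, h2, if_false, h1, Finset.sum_range_succ]
    have e2 : cocycle T f (-((m : ℤ) + 1) + 1) x =
        -∑ k ∈ Finset.range m, f (iter T (-(k + 1 : ℤ)) x) := by
      rcases Nat.eq_zero_or_pos m with rfl | hm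
      · simp [cocycle]
      · have h3 : ¬ (0 : ℤ) ≤ -((m : ℤ) + 1) + 1 := by omega
        have h4 : (-(-((m : ℤ) + 1) + 1)).toNat = m := by omega
        simp only [cocycle, h3, if_false, h4]
    rw [e, e2]; ring

theorem cocycle_lt_succ {X : Type*} [MeasurableSpace X] (T : X ≃ᵐ X) (f : X → ℝ)
    (hf : ∃ c > 0, ∀ x, c ≤ f x) (x : X) : StrictMono fun n : ℤ => cocycle T f n x := by
  obtain ⟨c, hc, h⟩ := hf
  refine strictMono_int_of_lt_succ fun n => ?_
  rw [cocycle_succ]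
  linarith [h (iter T n x)]

/-- For a roof function bounded away from `0`, every real number lies in exactly one of the
intervals `[f⁽ⁿ⁾(x), f⁽ⁿ⁺¹⁾(x))`, `n ∈ ℤ`. -/
theorem existsUnique_index {X : Type*} [MeasurableSpace X] (T : X ≃ᵐ X) (f : X → ℝ)
    (hf : ∃ c > 0, ∀ x, c ≤ f x) (x : X) (s : ℝ) :
    ∃! n : ℤ, cocycle T f n x ≤ s ∧ s < cocycle T f (n + 1) x := by
  have hmono := cocycle_lt_succ T f hf x
  obtain ⟨c, hc, h⟩ := hf
  have up : ∀ m : ℕ, c * m ≤ cocycle T f m x := by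
    intro m
    induction m with
    | zero => simp [cocycle]
    | succ m ih =>
      push_cast
      rw [cocycle_succ]
      linarith [h (iter T m x)]
  have down : ∀ m : ℕ, cocycle T f (-(m : ℤ)) x ≤ -(c * m) := by
    intro m
    induction m with
    | zero => simp [cocycle]
    | succ m ih =>
      have := cocycle_succ T f (-((m + 1 : ℕ) : ℤ)) x
      rw [show -((m + 1 : ℕ) : ℤ) + 1 = -(m : ℤ) by push_cast; ring] at this
      have h' := h (iter T (-((m + 1 : ℕ) : ℤ)) x)
      push_cast at *
      linarith
  obtain ⟨M, hM⟩ := exists_nat_gt (|s| / c)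
  have hM' : |s| < c * M := by rw [div_lt_iff₀ hc] at hM; linarith
  obtain ⟨n, hn, hmax⟩ := Int.exists_greatest_of_bdd (P := fun n => cocycle T f n x ≤ s)
    ⟨M, fun z hz => by
      by_contra hlt
      have := hmono (not_le.mp hlt)
      have := up M
      have := le_abs_self s
      simp only at *
      linarith⟩
    ⟨-(M : ℤ), by linarith [down M, neg_abs_le s]⟩
  refine ⟨n, ⟨hn, ?_⟩, ?_⟩
  · by_contra hlt
    have := hmax (n + 1) (not_lt.mp hlt)
    omega
  · rintro k ⟨hk1, hk2⟩
    refine le_antisymm (hmax k hk1) ?_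
    have : n < k + 1 := hmono.lt_iff_lt.mp (lt_of_le_of_lt hn hk2)
    omega

/-! ### The special flow -/

/-- The space `X^f = {(x, r) : 0 ≤ r < f(x)}` under the graph of the roof function. -/
def specialSpace {X : Type*} (f : X → ℝ) : Set (X × ℝ) :=
  {p | 0 ≤ p.2 ∧ p.2 < f p.1}

/-- The number `n` of returns to the base during time `s`, starting from `(x, 0)`: the unique
integer with `f⁽ⁿ⁾(x) ≤ s < f⁽ⁿ⁺¹⁾(x)`. -/
def returnIndex {X : Type*} [MeasurableSpace X] (T : X ≃ᵐ X) (f : X → ℝ)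
    (hf : ∃ c > 0, ∀ x, c ≤ f x) (x : X) (s : ℝ) : ℤ :=
  (existsUnique_index T f hf x s).choose

theorem returnIndex_spec {X : Type*} [MeasurableSpace X] (T : X ≃ᵐ X) (f : X → ℝ)
    (hf : ∃ c > 0, ∀ x, c ≤ f x) (x : X) (s : ℝ) :
    cocycle T f (returnIndex T f hf x s) x ≤ s ∧
      s < cocycle T f (returnIndex T f hf x s + 1) x :=
  (existsUnique_index T f hf x s).choose_spec.1

/-- The special flow `T^f_t(x, r) = (Tⁿx, r + t - f⁽ⁿ⁾(x))`, where `n` is the unique integer with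
`f⁽ⁿ⁾(x) ≤ r + t < f⁽ⁿ⁺¹⁾(x)`. -/
def specialFlow {X : Type*} [MeasurableSpace X] (T : X ≃ᵐ X) (f : X → ℝ)
    (hf : ∃ c > 0, ∀ x, c ≤ f x) (t : ℝ) (y : specialSpace f) : specialSpace f :=
  ⟨(iter T (returnIndex T f hf y.1.1 (y.1.2 + t)) y.1.1,
      y.1.2 + t - cocycle T f (returnIndex T f hf y.1.1 (y.1.2 + t)) y.1.1), by
    have h := returnIndex_spec T f hf y.1.1 (y.1.2 + t)
    rw [cocycle_succ] at h
    exact ⟨by simp only; linarith [h.1], by simp only; linarith [h.2]⟩⟩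

/-- The restriction of `μ ⊗ Leb` to `X^f`; its total mass is `∫ f dμ`. -/
def specialMeasure {X : Type*} [MeasurableSpace X] (μ : Measure X) (f : X → ℝ) :
    Measure (specialSpace f) :=
  (μ.prod volume).comap Subtype.val

/-- The restriction of `μ ⊗ Leb` to `X^f`, normalized to a probability measure. -/
def specialProb {X : Type*} [MeasurableSpace X] (μ : Measure X) (f : X → ℝ) :
    Measure (specialSpace f) :=
  (specialMeasure μ f univ)⁻¹ • specialMeasure μ f

/-! ### 3-self-joinings of a flow -/

/-- `l` is a 3-self-joining of the flow `Φ` on `(Y, m)`: a probability measure on `Y³`, invariant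
under `Φ t × Φ t × Φ t` for all `t`, whose three coordinate projections are all `m`. -/
structure IsJoining3 {Y : Type*} [MeasurableSpace Y] (Φ : ℝ → Y → Y) (m : Measure Y)
    (l : Measure (Y × Y × Y)) : Prop where
  prob : IsProbabilityMeasure l
  invariant : ∀ t, l.map (fun p => (Φ t p.1, Φ t p.2.1, Φ t p.2.2)) = l
  proj_one : l.map (fun p => p.1) = m
  proj_two : l.map (fun p => p.2.1) = m
  proj_three : l.map (fun p => p.2.2) = m

/-- Convergence of a sequence in the space `J₃` of 3-self-joinings with its weak topology, that is,
convergence of the measures of all measurable boxes `A × B × C`. -/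
structure TendstoJoining3 {Y : Type*} [MeasurableSpace Y] (Φ : ℝ → Y → Y) (m : Measure Y)
    (l : ℕ → Measure (Y × Y × Y)) (l' : Measure (Y × Y × Y)) : Prop where
  joining : ∀ n, IsJoining3 Φ m (l n)
  joining_limit : IsJoining3 Φ m l'
  tendsto : ∀ A B C : Set Y, MeasurableSet A → MeasurableSet B → MeasurableSet C →
    Tendsto (fun n => l n (A ×ˢ B ×ˢ C)) atTop (𝓝 (l' (A ×ˢ B ×ˢ C)))

/-- The off-diagonal 3-joining `m_{t,u}`, the image of `m` under `y ↦ (Φ t y, Φ u y, y)`; thus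
`m_{t,u}(A × B × C) = m(Φ_{-t} A ∩ Φ_{-u} B ∩ C)`. -/
def offDiagonal3 {Y : Type*} [MeasurableSpace Y] (Φ : ℝ → Y → Y) (m : Measure Y) (t u : ℝ) :
    Measure (Y × Y × Y) :=
  m.map fun y => (Φ t y, Φ u y, y)

/-- The integral joining `∫ m_{-t,-u} dP(t,u)`, i.e. `A ↦ ∫ m_{-t,-u}(A) dP(t,u)`. -/
def integralJoining3 {Y : Type*} [MeasurableSpace Y] (Φ : ℝ → Y → Y) (m : Measure Y)
    (P : Measure (ℝ × ℝ)) : Measure (Y × Y × Y) :=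
  P.bind fun p => offDiagonal3 Φ m (-p.1) (-p.2)

/-! ### The assumptions -/

/-- `q` is a rigidity sequence for `T` along the sets `V n`. -/
def IsRigiditySeqAlong {X : Type*} [MeasurableSpace X] (μ : Measure X) (T : X ≃ᵐ X)
    (V : ℕ → Set X) (q : ℕ → ℕ) : Prop :=
  StrictMono q ∧ ∀ A : Set X, MeasurableSet A →
    Tendsto (fun n => μ (symmDiff ((T : X → X)^[q n] ⁻¹' A) A ∩ V n)) atTop (𝓝 0)

/-- The centred Birkhoff sum `f⁽q⁾ - a`. -/
def centred {X : Type*} [MeasurableSpace X] (T : X ≃ᵐ X) (f : X → ℝ) (q : ℕ) (a : ℝ) (x : X) : ℝ :=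
  cocycle T f q x - a

end

/-! ### Powers of an automorphism and the skew translations -/

section Algebra

variable {X : Type*} [MeasurableSpace X] (T : X ≃ᵐ X) (f : X → ℝ)

/-! The special flow is vertical translation on `X × ℝ`, read modulo the `ℤ`-action `skewShift`.
Moving `(x, r + a_n)` along its orbit by `q_n` steps gives `T^f_{a_n}(x, r) = [T^{q_n} x, r -
f_n(x)]`, where the bracket denotes the projection to `X^f`, and likewise for the primed data. Over
`W_n` rigidity makes `T^{q_n} x` and `T^{q_n'} x` indistinguishable from `x`. So there `(T^f_{a_n'},
T^f_{a_n})` acts like the pair of flow maps with times `-f_n'(x)` and `-f_n(x)`.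

Hence the part of `μ^f_{a_n',a_n}(A × B × C)` over `W_n` is, up to normalization and `o(1)`, the
integral over `W_n` of `G(x, (f_n'(x), f_n(x)))`. Here `G(x, (t, u))` is the length of the set of
`r` in `[0, f(x))` with `[x, r - t] ∈ A`, `[x, r - u] ∈ B`, `[x, r] ∈ C`. It is continuous in `(t,
u)` and bounded by the integrable function `f`.

The base point and `(f_n', f_n)` become independent: `f_n ∘ T - f_n = f ∘ T^{q_n} - f` tends to `0`
in measure along `W_n`, so functions of `(f_n', f_n)` cut off to `W_n` are almost `T`-invariant. By
ergodicity, in the form of von Neumann's splitting of `L²`, they decorrelate from every event. The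
limit is therefore `α ∫∫ G dP dμ`, which is `α` times the integral joining
(`tendsto_setIntegral_of_caratheodory`, `tendsto_setLIntegral_fibreOverlap`,
`tendsto_offDiagonal3_restrict`).

The part over the complement of `W_n` has mass tending to `1 - α` and marginals dominated by `μ^f`.
Compactness yields a limit along a subsequence (`exists_subseq_tendsto_box`), and its normalization
`ν` is a joining because the total limit and the integral joining are
(`exists_subseq_tendstoJoining3_of_partial`). -/

theorem iter_zero (x : X) : iter T 0 x = x := rfl

theorem iter_add (m n : ℤ) (x : X) : iter T (m + n) x = iter T m (iter T n x) := by
  simp [iter, zpow_add]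

theorem iter_one (x : X) : iter T 1 x = T x := by simp [iter]

theorem iter_natCast (n : ℕ) (x : X) : iter T n x = T^[n] x := by
  simp only [iter, zpow_natCast, Equiv.Perm.coe_pow]
  rfl

theorem measurable_iter (n : ℤ) : Measurable (iter T n) := by
  have h1 : Measurable (iter T (-1)) := by
    have : iter T (-1) = T.symm := by
      ext x
      simp only [iter, zpow_neg, zpow_one]
      rfl
    rw [this]
    exact T.symm.measurable
  induction n using Int.induction_on with
  | zero => exact measurable_id
  | succ n ih =>
    have : iter T (n + 1) = iter T n ∘ T := by
      ext x; rw [iter_add, iter_one]; rfl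
    rw [this]; exact ih.comp T.measurable
  | pred n ih =>
    have : iter T (-n - 1) = iter T (-n) ∘ iter T (-1) := by
      ext x; rw [sub_eq_add_neg, iter_add]; rfl
    rw [this]; exact ih.comp h1

theorem measurePreserving_iter {μ : Measure X} (hT : MeasurePreserving T μ μ) (n : ℤ) :
    MeasurePreserving (iter T n) μ μ := by
  obtain ⟨m, rfl | rfl⟩ := n.eq_nat_or_neg
  · rw [show iter T m = T^[m] from funext (iter_natCast T m)]
    exact hT.iterate m
  · rw [show iter T (-m) = T.symm^[m] from ?_]
    · exact (hT.symm T).iterate m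
    · ext x
      have h : T^[m] (iter T (-m) x) = x := by
        rw [← iter_natCast, ← iter_add]; simp [iter_zero]
      have h2 : T^[m] (T.symm^[m] x) = x :=
        (Function.LeftInverse.iterate (fun y => T.apply_symm_apply y) m) x
      exact (T.injective.iterate m) (h.trans h2.symm)

theorem cocycle_zero (x : X) : cocycle T f 0 x = 0 := by simp [cocycle]

theorem cocycle_add (m n : ℤ) (x : X) :
    cocycle T f (m + n) x = cocycle T f n x + cocycle T f m (iter T n x) := by
  induction m using Int.induction_on with
  | zero => simp [cocycle_zero]
  | succ m ih =>
    rw [show (m : ℤ) + 1 + n = m + n + 1 by ring, cocycle_succ, cocycle_succ, ih, iter_add]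
    ring
  | pred m ih =>
    have h1 := cocycle_succ T f (-(m : ℤ) - 1 + n) x
    have h2 := cocycle_succ T f (-(m : ℤ) - 1) (iter T n x)
    rw [show -(m : ℤ) - 1 + n + 1 = -m + n by ring, iter_add] at h1
    rw [sub_add_cancel] at h2
    linarith

theorem cocycle_one (x : X) : cocycle T f 1 x = f x := by
  have := cocycle_succ T f 0 x
  simpa [cocycle_zero, iter_zero] using this

/-- Both ways of splitting `f⁽ⁿ⁺¹⁾`, at the first or at the last summand, are compared. This is how
rigidity of `T` becomes almost invariance of the centred sums. -/
theorem cocycle_apply_sub (n : ℤ) (x : X) :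
    cocycle T f n (T x) - cocycle T f n x = f (iter T n x) - f x := by
  have h1 := cocycle_add T f n 1 x
  rw [cocycle_succ, iter_one, cocycle_one] at h1
  linarith

theorem measurable_cocycle (hf : Measurable f) (n : ℤ) : Measurable (cocycle T f n) := by
  unfold cocycle
  split_ifs
  · exact Finset.measurable_sum _ fun k _ => hf.comp (measurable_iter T k)
  · exact (Finset.measurable_sum _ fun k _ => hf.comp (measurable_iter T _)).neg

/-- The `ℤ`-action on `X × ℝ` of which the special space is a fundamental domain. -/
def skewShift (n : ℤ) (p : X × ℝ) : X × ℝ := (iter T n p.1, p.2 - cocycle T f n p.1)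

theorem skewShift_zero (p : X × ℝ) : skewShift T f 0 p = p := by
  simp [skewShift, iter_zero, cocycle_zero]

theorem skewShift_add (m n : ℤ) (p : X × ℝ) :
    skewShift T f (m + n) p = skewShift T f m (skewShift T f n p) := by
  simp only [skewShift, iter_add, cocycle_add, sub_sub]

/-- Vertical translations commute with the action, so they descend to the orbit space; the descended
flow is the special flow. -/
theorem skewShift_translate (n : ℤ) (p : X × ℝ) (t : ℝ) :
    skewShift T f n (p.1, p.2 + t) =
      ((skewShift T f n p).1, (skewShift T f n p).2 + t) := by
  simp only [skewShift]; congr 1; ring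

theorem measurable_skewShift (hf : Measurable f) (n : ℤ) : Measurable (skewShift T f n) :=
  ((measurable_iter T n).comp measurable_fst).prodMk
    (measurable_snd.sub ((measurable_cocycle T f hf n).comp measurable_fst))

theorem measurePreserving_skewShift {μ : Measure X} [SFinite μ] (hT : MeasurePreserving T μ μ)
    (hf : Measurable f) (n : ℤ) :
    MeasurePreserving (skewShift T f n) (μ.prod volume) (μ.prod volume) :=
  (measurePreserving_iter T hT n).skew_product (g := fun x s => s - cocycle T f n x)
    (measurable_snd.sub ((measurable_cocycle T f hf n).comp measurable_fst))
    (ae_of_all _ fun x => (measurePreserving_sub_right volume (cocycle T f n x)).map_eq)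

theorem measurableSet_specialSpace (hf : Measurable f) : MeasurableSet (specialSpace f) :=
  (measurableSet_le measurable_const measurable_snd).inter
    (measurableSet_lt measurable_snd (hf.comp measurable_fst))

end Algebra

/-! ### The special space as a fundamental domain -/

section Projection

variable {X : Type*} [MeasurableSpace X] (T : X ≃ᵐ X) (f : X → ℝ) (hf : ∃ c > 0, ∀ x, c ≤ f x)

theorem skewShift_mem_iff (n : ℤ) (p : X × ℝ) :
    skewShift T f n p ∈ specialSpace f ↔
      cocycle T f n p.1 ≤ p.2 ∧ p.2 < cocycle T f (n + 1) p.1 := by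
  simp only [skewShift, specialSpace, mem_ofPred_eq, cocycle_succ]
  constructor <;> rintro ⟨h1, h2⟩ <;> constructor <;> linarith

theorem existsUnique_skewShift_mem (hf : ∃ c > 0, ∀ x, c ≤ f x) (p : X × ℝ) : ∃! n, skewShift T f n p ∈ specialSpace f := by
  simpa only [skewShift_mem_iff] using existsUnique_index T f hf p.1 p.2

/-- The projection of `X × ℝ` to the special space along the orbits of `skewShift`. -/
noncomputable def specialProj (p : X × ℝ) : specialSpace f :=
  ⟨skewShift T f (returnIndex T f hf p.1 p.2) p,
    (skewShift_mem_iff T f _ p).2 (returnIndex_spec T f hf p.1 p.2)⟩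

theorem specialFlow_eq (t : ℝ) (y : specialSpace f) :
    specialFlow T f hf t y = specialProj T f hf (y.1.1, y.1.2 + t) := rfl

theorem specialProj_eq_of_mem {p : X × ℝ} {n : ℤ} (h : skewShift T f n p ∈ specialSpace f) :
    (specialProj T f hf p : X × ℝ) = skewShift T f n p := by
  have := (existsUnique_skewShift_mem T f hf p).unique h (specialProj T f hf p).2
  rw [this]; rfl

theorem specialProj_skewShift (n : ℤ) (p : X × ℝ) :
    specialProj T f hf (skewShift T f n p) = specialProj T f hf p := by
  apply Subtype.ext
  have h := (specialProj T f hf p).2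
  have e : (specialProj T f hf p : X × ℝ) =
      skewShift T f (returnIndex T f hf p.1 p.2 - n) (skewShift T f n p) := by
    rw [← skewShift_add, sub_add_cancel]; rfl
  rw [e] at h ⊢
  exact specialProj_eq_of_mem T f hf h

theorem specialProj_coe (y : specialSpace f) : specialProj T f hf y = y := by
  apply Subtype.ext
  rw [specialProj_eq_of_mem T f hf (n := 0) (by rw [skewShift_zero]; exact y.2), skewShift_zero]

theorem specialFlow_specialProj (t : ℝ) (p : X × ℝ) :
    specialFlow T f hf t (specialProj T f hf p) = specialProj T f hf (p.1, p.2 + t) := by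
  rw [specialFlow_eq, ← specialProj_skewShift T f hf (returnIndex T f hf p.1 p.2) (p.1, p.2 + t),
    skewShift_translate]
  rfl

theorem specialFlow_add (s t : ℝ) (y : specialSpace f) :
    specialFlow T f hf (s + t) y = specialFlow T f hf s (specialFlow T f hf t y) := by
  rw [specialFlow_eq T f hf t, specialFlow_specialProj, specialFlow_eq]
  congr 2; ring

theorem specialFlow_comm (s t : ℝ) (y : specialSpace f) :
    specialFlow T f hf s (specialFlow T f hf t y) =
      specialFlow T f hf t (specialFlow T f hf s y) := by
  rw [← specialFlow_add, add_comm, specialFlow_add]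

theorem measurable_specialProj (hfm : Measurable f) : Measurable (specialProj T f hf) := by
  have hidx : Measurable fun p : X × ℝ => returnIndex T f hf p.1 p.2 := by
    refine measurable_to_countable' fun n => ?_
    have : (fun p : X × ℝ => returnIndex T f hf p.1 p.2) ⁻¹' {n} =
        skewShift T f n ⁻¹' specialSpace f := by
      ext p
      refine ⟨fun h => ?_, fun h => ?_⟩
      · rw [mem_preimage, mem_singleton_iff] at h
        rw [← h]
        exact (specialProj T f hf p).2
      · exact (existsUnique_skewShift_mem T f hf p).unique (specialProj T f hf p).2 h
    rw [this]
    exact measurable_skewShift T f hfm n (measurableSet_specialSpace f hfm)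
  have hact : Measurable fun q : ℤ × (X × ℝ) => skewShift T f q.1 q.2 :=
    measurable_from_prod_countable_right fun n => measurable_skewShift T f hfm n
  have hpair : Measurable fun p : X × ℝ => (returnIndex T f hf p.1 p.2, p) :=
    hidx.prodMk measurable_id
  have hcoe : Measurable fun p => (specialProj T f hf p : X × ℝ) := hact.comp hpair
  exact hcoe.subtype_mk (h := fun p => (specialProj T f hf p).2)

theorem measurable_specialFlow_uncurry (hfm : Measurable f) :
    Measurable fun q : ℝ × specialSpace f => specialFlow T f hf q.1 q.2 := by
  have hpair : Measurable fun q : ℝ × specialSpace f => (q.2.1.1, q.2.1.2 + q.1) := by fun_prop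
  exact (measurable_specialProj T f hf hfm).comp hpair

theorem measurable_specialFlow (hfm : Measurable f) (t : ℝ) :
    Measurable (specialFlow T f hf t) := by
  have hpair : Measurable fun y : specialSpace f => (y.1.1, y.1.2 + t) := by fun_prop
  exact (measurable_specialProj T f hf hfm).comp hpair

theorem specialMeasure_apply (hfm : Measurable f) (μ : Measure X) {S : Set (specialSpace f)}
    (hS : MeasurableSet S) :
    specialMeasure μ f S =
      μ.prod volume (specialSpace f ∩ specialProj T f hf ⁻¹' S) := by
  rw [specialMeasure, Measure.comap_apply _ Subtype.val_injective
    (fun s hs => (measurableSet_specialSpace f hfm).subtype_image hs) _ hS]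
  congr 1
  ext p
  constructor
  · rintro ⟨y, hy, rfl⟩
    exact ⟨y.2, by rwa [mem_preimage, specialProj_coe]⟩
  · rintro ⟨h1, h2⟩
    exact ⟨⟨p, h1⟩, by rwa [mem_preimage, specialProj_coe T f hf ⟨p, h1⟩] at h2, rfl⟩

/-- A set that meets every `skewShift`-orbit exactly once has the same intersection measure with
invariant sets as the special space. -/
theorem measure_inter_of_existsUnique (hf : ∃ c > 0, ∀ x, c ≤ f x) (hfm : Measurable f) {μ : Measure X} [SFinite μ]
    (hT : MeasurePreserving T μ μ) {D U : Set (X × ℝ)} (hD : MeasurableSet D)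
    (hD1 : ∀ p, ∃! n, skewShift T f n p ∈ D) (hU : MeasurableSet U)
    (hUinv : ∀ n p, skewShift T f n p ∈ U ↔ p ∈ U) :
    μ.prod volume (D ∩ U) = μ.prod volume (specialSpace f ∩ U) := by
  -- `D₂` is sliced according to the unique shift that brings a point into `D₁`.
  have key : ∀ D₁ D₂ : Set (X × ℝ), MeasurableSet D₁ → MeasurableSet D₂ →
      (∀ p, ∃! n, skewShift T f n p ∈ D₁) → μ.prod volume (D₂ ∩ U) =
        ∑' n : ℤ, μ.prod volume (skewShift T f n ⁻¹' D₁ ∩ D₂ ∩ U) := by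
    intro D₁ D₂ h₁ h₂ h
    rw [← measure_iUnion]
    · congr 1
      ext p
      simp only [mem_inter_iff, mem_iUnion, mem_preimage]
      exact ⟨fun hp => ⟨_, ⟨(h p).choose_spec.1, hp.1⟩, hp.2⟩, fun ⟨n, hn⟩ => ⟨hn.1.2, hn.2⟩⟩
    · intro m n hmn
      refine Set.disjoint_left.2 fun p hp hq => hmn ?_
      exact (h p).unique hp.1.1 hq.1.1
    · exact fun n => ((measurable_skewShift T f hfm n h₁).inter h₂).inter hU
  -- A measure-preserving shift matches the slice of index `n` of one set with the slice of index
  -- `-n` of the other.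
  rw [key _ _ (measurableSet_specialSpace f hfm) hD (existsUnique_skewShift_mem T f hf),
    key _ _ hD (measurableSet_specialSpace f hfm) hD1, ← (Equiv.neg ℤ).tsum_eq]
  refine tsum_congr fun n => ?_
  rw [← (measurePreserving_skewShift T f hT hfm n).measure_preimage]
  · congr 1
    ext p
    simp only [mem_inter_iff, mem_preimage, Equiv.neg_apply, ← skewShift_add, hUinv,
      neg_add_cancel, skewShift_zero]
    tauto
  · exact (((measurable_skewShift T f hfm _ (measurableSet_specialSpace f hfm)).inter
      hD).inter hU).nullMeasurableSet

/-- A vertical translate of the special space is again a fundamental domain, and the lift of `S` to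
`X × ℝ` is an invariant set, so both domains cut out the same measure from it. -/
theorem measurePreserving_specialFlow (hfm : Measurable f) {μ : Measure X} [SFinite μ]
    (hT : MeasurePreserving T μ μ) (t : ℝ) :
    MeasurePreserving (specialFlow T f hf t) (specialMeasure μ f) (specialMeasure μ f) := by
  refine ⟨measurable_specialFlow T f hf hfm t, ?_⟩
  ext S hS
  have hflow := measurable_specialFlow T f hf hfm t
  have hproj := measurable_specialProj T f hf hfm
  have htr : ∀ u : ℝ, MeasurePreserving (fun p : X × ℝ => (p.1, p.2 + u)) (μ.prod volume)
      (μ.prod volume) := fun u =>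
    (MeasurePreserving.id μ).prod (measurePreserving_add_right volume u)
  have hm : MeasurableSet ((fun p : X × ℝ => (p.1, p.2 + -t)) ⁻¹' specialSpace f) :=
    (htr (-t)).measurable (measurableSet_specialSpace f hfm)
  rw [Measure.map_apply hflow hS, specialMeasure_apply T f hf hfm μ (hflow hS),
    specialMeasure_apply T f hf hfm μ hS,
    ← measure_inter_of_existsUnique T f hf hfm hT hm ?_ (hproj hS), ← (htr (-t)).measure_preimage]
  · congr 1
    ext p
    simp [specialFlow_specialProj]
  · exact ((measurableSet_specialSpace f hfm).inter (hproj (hflow hS))).nullMeasurableSet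
  · intro n p
    rw [mem_preimage, specialProj_skewShift, mem_preimage]
  · intro p
    have := existsUnique_skewShift_mem T f hf (p.1, p.2 + -t)
    simpa only [skewShift_translate, mem_preimage] using this

end Projection

/-! ### Normalization of the measure on the special space -/

section Probability

variable {X : Type*} [MeasurableSpace X] (T : X ≃ᵐ X) (f : X → ℝ) (hf : ∃ c > 0, ∀ x, c ≤ f x)

theorem specialMeasure_univ (hfm : Measurable f) (μ : Measure X) [SFinite μ] :
    specialMeasure μ f univ = ∫⁻ x, ENNReal.ofReal (f x) ∂μ := by
  rw [specialMeasure, Measure.comap_apply _ Subtype.val_injective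
    (fun s hs => (measurableSet_specialSpace f hfm).subtype_image hs) _ .univ, image_univ,
    Subtype.range_coe, Measure.prod_apply (measurableSet_specialSpace f hfm)]
  refine lintegral_congr fun x => ?_
  have : Prod.mk x ⁻¹' specialSpace f = Ico 0 (f x) := rfl
  rw [this, Real.volume_Ico, sub_zero]

theorem specialMeasure_univ_ne_zero (hf : ∃ c > 0, ∀ x, c ≤ f x) (hfm : Measurable f) (μ : Measure X) [IsProbabilityMeasure μ] :
    specialMeasure μ f univ ≠ 0 := by
  obtain ⟨c, hc, h⟩ := hf
  rw [specialMeasure_univ f hfm]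
  refine ((ENNReal.ofReal_pos.2 hc).trans_le ?_).ne'
  calc ENNReal.ofReal c = ∫⁻ _, ENNReal.ofReal c ∂μ := by simp
    _ ≤ _ := lintegral_mono fun x => ENNReal.ofReal_le_ofReal (h x)

theorem specialMeasure_univ_ne_top (hfm : Measurable f) (μ : Measure X) [SFinite μ]
    (hfi : Integrable f μ) : specialMeasure μ f univ ≠ ⊤ := by
  rw [specialMeasure_univ f hfm]
  exact (hfi.lintegral_lt_top).ne

theorem isProbabilityMeasure_specialProb (hf : ∃ c > 0, ∀ x, c ≤ f x) (hfm : Measurable f) (μ : Measure X)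
    [IsProbabilityMeasure μ] (hfi : Integrable f μ) :
    IsProbabilityMeasure (specialProb μ f) := by
  refine ⟨?_⟩
  rw [specialProb, Measure.smul_apply, smul_eq_mul]
  exact ENNReal.inv_mul_cancel (specialMeasure_univ_ne_zero f hf hfm μ)
    (specialMeasure_univ_ne_top f hfm μ hfi)

theorem measurePreserving_specialFlow_specialProb (hfm : Measurable f) {μ : Measure X} [SFinite μ]
    (hT : MeasurePreserving T μ μ) (t : ℝ) :
    MeasurePreserving (specialFlow T f hf t) (specialProb μ f) (specialProb μ f) :=
  (measurePreserving_specialFlow T f hf hfm hT t).smul_measure _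

end Probability

/-! ### Convergence of dominated measures -/

section Dominated

variable {Y Z : Type*} [MeasurableSpace Y] [MeasurableSpace Z]

/-- Domination by a finite measure is what lets the class of good sets pass to countable disjoint
unions: the series of measures converge by dominated convergence for the counting measure. -/
theorem tendsto_measure_of_isPiSystem {m ν : Measure Y} [IsFiniteMeasure m] {νs : ℕ → Measure Y}
    (hνs : ∀ n, νs n ≤ m) (hν : ν ≤ m) {S : Set (Set Y)}
    (hgen : ‹MeasurableSpace Y› = MeasurableSpace.generateFrom S) (hpi : IsPiSystem S)
    (huniv : Tendsto (fun n => νs n univ) atTop (𝓝 (ν univ)))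
    (hS : ∀ A ∈ S, Tendsto (fun n => νs n A) atTop (𝓝 (ν A)))
    {A : Set Y} (hA : MeasurableSet A) : Tendsto (fun n => νs n A) atTop (𝓝 (ν A)) := by
  have hfin : ∀ {κ : Measure Y}, κ ≤ m → ∀ B, κ B ≠ ⊤ := fun h B =>
    ((h B).trans_lt (measure_lt_top m B)).ne
  induction A, hA using MeasurableSpace.induction_on_inter hgen hpi with
  | empty => simp
  | basic A hA => exact hS A hA
  | compl A hA ih =>
    have h1 : ∀ n, νs n Aᶜ = νs n univ - νs n A := fun n =>
      measure_compl hA (hfin (hνs n) A)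
    simp_rw [h1, measure_compl hA (hfin hν A)]
    exact ENNReal.Tendsto.sub huniv ih (Or.inl (hfin hν univ))
  | iUnion A hd hA ih =>
    simp_rw [fun κ : Measure Y => measure_iUnion (μ := κ) hd hA, ← lintegral_count]
    refine tendsto_lintegral_of_dominated_convergence (fun k => m (A k))
      (fun n => measurable_from_nat) (fun n => ae_of_all _ fun k => hνs n (A k)) ?_
      (ae_of_all _ ih)
    rw [lintegral_count, ← measure_iUnion hd hA]
    exact measure_ne_top _ _

/-- Convergence of the measures of the sets `g ⁻¹' A ∩ R` extends from a generating `π`-system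
if the image measures under `g` are dominated. -/
theorem tendsto_measure_preimage_inter {m : Measure Y} [IsFiniteMeasure m] {ρ : Measure Z}
    {ρs : ℕ → Measure Z} {g : Z → Y} (hg : Measurable g)
    (hρs : ∀ n, (ρs n).map g ≤ m) (hρ : ρ.map g ≤ m) {R : Set Z} {S : Set (Set Y)}
    (hgen : ‹MeasurableSpace Y› = MeasurableSpace.generateFrom S) (hpi : IsPiSystem S)
    (huniv : univ ∈ S)
    (hS : ∀ A ∈ S, Tendsto (fun n => ρs n (g ⁻¹' A ∩ R)) atTop (𝓝 (ρ (g ⁻¹' A ∩ R))))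
    {A : Set Y} (hA : MeasurableSet A) :
    Tendsto (fun n => ρs n (g ⁻¹' A ∩ R)) atTop (𝓝 (ρ (g ⁻¹' A ∩ R))) := by
  have hle : ∀ κ : Measure Z, κ.map g ≤ m → (κ.restrict R).map g ≤ m := fun κ h =>
    (Measure.map_mono Measure.restrict_le_self hg).trans h
  have heq : ∀ (κ : Measure Z) (B : Set Y), MeasurableSet B →
      (κ.restrict R).map g B = κ (g ⁻¹' B ∩ R) := fun κ B hB => by
    rw [Measure.map_apply hg hB, Measure.restrict_apply (hg hB)]
  have hmeas : ∀ B ∈ S, MeasurableSet B := fun B hB => by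
    rw [hgen]; exact MeasurableSpace.measurableSet_generateFrom hB
  have hS' : ∀ B ∈ S, Tendsto (fun n => ((ρs n).restrict R).map g B) atTop
      (𝓝 ((ρ.restrict R).map g B)) := fun B hB => by
    simpa only [heq _ _ (hmeas B hB)] using hS B hB
  simpa only [heq _ _ hA] using tendsto_measure_of_isPiSystem (fun n => hle _ (hρs n))
    (hle _ hρ) hgen hpi (hS' univ huniv) hS' hA

end Dominated

/-! ### Continuity sets generate the Borel sets -/

section NullFrontier

variable {Y : Type*} [TopologicalSpace Y] [MeasurableSpace Y]

theorem isPiSystem_null_frontier (m : Measure Y) :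
    IsPiSystem {A : Set Y | MeasurableSet A ∧ m (frontier A) = 0} := fun A hA B hB _ =>
  ⟨hA.1.inter hB.1, measure_mono_null (frontier_inter_subset A B)
    (measure_union_null (measure_mono_null inter_subset_left hA.2)
      (measure_mono_null inter_subset_right hB.2))⟩

/-- A closed set is the intersection of its open thickenings, and arbitrarily small radii give
thickenings with null frontier. -/
theorem generateFrom_null_frontier [TopologicalSpace.PseudoMetrizableSpace Y] [BorelSpace Y]
    (m : Measure Y) [IsFiniteMeasure m] :
    ‹MeasurableSpace Y› =
      MeasurableSpace.generateFrom {A : Set Y | MeasurableSet A ∧ m (frontier A) = 0} := by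
  let : PseudoMetricSpace Y := TopologicalSpace.pseudoMetrizableSpacePseudoMetric Y
  refine le_antisymm ?_ (MeasurableSpace.generateFrom_le fun A hA => hA.1)
  refine (BorelSpace.measurable_eq (α := Y)).le.trans ?_
  rw [borel_eq_generateFrom_isClosed]
  refine MeasurableSpace.generateFrom_le fun F hF => ?_
  have h : ∀ k : ℕ, ∃ r ∈ Ioo (0 : ℝ) (1 / (k + 1)), m (frontier (Metric.thickening r F)) = 0 :=
    fun k => exists_null_frontier_thickening m F (by positivity)
  choose r hr hr0 using h
  have hlim : Tendsto r atTop (𝓝 0) :=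
    tendsto_of_tendsto_of_tendsto_of_le_of_le tendsto_const_nhds
      tendsto_one_div_add_atTop_nhds_zero_nat (fun k => (hr k).1.le) fun k => (hr k).2.le
  have hF' : F = ⋂ k, Metric.thickening (r k) F := by
    refine subset_antisymm (subset_iInter fun k => Metric.self_subset_thickening (hr k).1 F) ?_
    intro y hy
    rw [← hF.closure_eq, Metric.closure_eq_iInter_thickening, mem_iInter₂]
    intro δ hδ
    obtain ⟨k, hk⟩ := (hlim.eventually (gt_mem_nhds hδ)).exists
    exact Metric.thickening_mono hk.le F (mem_iInter.1 hy k)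
  rw [hF']
  refine MeasurableSet.iInter fun k => MeasurableSpace.measurableSet_generateFrom ?_
  exact ⟨Metric.isOpen_thickening.measurableSet, hr0 k⟩

end NullFrontier

/-! ### Compactness of the set of couplings -/

section Compactness

variable {Y : Type*} [MeasurableSpace Y]

/-- Outer regularity of `m` reduces the inequality to open sets, where the portmanteau theorem
bounds the limit by the lower limit. -/
theorem map_le_of_tendsto {Z : Type*} [TopologicalSpace Y] [BorelSpace Y]
    [TopologicalSpace.PseudoMetrizableSpace Y]
    [MeasurableSpace Z] [TopologicalSpace Z] [OpensMeasurableSpace Z] [HasOuterApproxClosed Z]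
    {m : Measure Y} [IsFiniteMeasure m] {ρs : ℕ → ProbabilityMeasure Z}
    {ρ : ProbabilityMeasure Z} (h : Tendsto ρs atTop (𝓝 ρ)) {g : Z → Y} (hg : Continuous g)
    (hle : ∀ n, (ρs n : Measure Z).map g ≤ m) : (ρ : Measure Z).map g ≤ m := by
  have hgm : Measurable g := hg.measurable
  refine Measure.le_iff'.2 fun A => ?_
  rw [A.measure_eq_iInf_isOpen m]
  refine le_iInf₂ fun U hAU => le_iInf fun hU => ?_
  refine (measure_mono hAU).trans ?_
  rw [Measure.map_apply hgm hU.measurableSet]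
  refine (ProbabilityMeasure.le_liminf_measure_open_of_tendsto h (hU.preimage hg)).trans ?_
  refine liminf_le_of_le (by isBoundedDefault) fun b hb => ?_
  obtain ⟨n, hn⟩ := hb.exists
  refine hn.trans ?_
  rw [← Measure.map_apply hgm hU.measurableSet]
  exact hle n U

theorem isTightMeasureSet_of_le [TopologicalSpace Y] {m : Measure Y}
    (hm : IsTightMeasureSet {m}) {S : Set (Measure Y)} (h : ∀ κ ∈ S, κ ≤ m) :
    IsTightMeasureSet S := by
  rw [isTightMeasureSet_iff_exists_isCompact_measure_compl_le] at hm ⊢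
  intro ε hε
  obtain ⟨K, hK, hle⟩ := hm ε hε
  exact ⟨K, hK, fun κ hκ => (h κ hκ _).trans (hle m rfl)⟩

/-- Probability measures on `Y³` with uniformly dominated marginals are sequentially relatively
compact for the convergence on all measurable boxes. -/
theorem exists_subseq_tendsto_box [StandardBorelSpace Y] (m : Measure Y) [IsFiniteMeasure m]
    (ρs : ℕ → Measure (Y × Y × Y)) [∀ n, IsProbabilityMeasure (ρs n)]
    (h1 : ∀ n, (ρs n).map (fun p => p.1) ≤ m) (h2 : ∀ n, (ρs n).map (fun p => p.2.1) ≤ m)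
    (h3 : ∀ n, (ρs n).map (fun p => p.2.2) ≤ m) :
    ∃ j : ℕ → ℕ, StrictMono j ∧ ∃ ρ : Measure (Y × Y × Y), IsProbabilityMeasure ρ ∧
      ∀ A B C, MeasurableSet A → MeasurableSet B → MeasurableSet C →
        Tendsto (fun n => ρs (j n) (A ×ˢ B ×ˢ C)) atTop (𝓝 (ρ (A ×ˢ B ×ˢ C))) := by
  -- Any Polish topology generating the σ-algebra will do: it serves Prokhorov's theorem and the
  -- portmanteau theorem, while convergence on boxes does not depend on it.
  let := upgradeStandardBorel Y
  let P : ℕ → ProbabilityMeasure (Y × Y × Y) := fun n => ⟨ρs n, inferInstance⟩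
  have hm : IsTightMeasureSet {m} := isTightMeasureSet_singleton
  have htight : IsTightMeasureSet 
      {((κ : ProbabilityMeasure (Y × Y × Y)) : Measure (Y × Y × Y)) | κ ∈ range P} := by
    refine IsTightMeasureSet.prodMk (isTightMeasureSet_of_le hm ?_)
      (IsTightMeasureSet.prodMk (isTightMeasureSet_of_le hm ?_) (isTightMeasureSet_of_le hm ?_))
    · rintro _ ⟨_, ⟨_, ⟨n, rfl⟩, rfl⟩, rfl⟩
      exact h1 n
    · rintro _ ⟨_, ⟨_, ⟨_, ⟨n, rfl⟩, rfl⟩, rfl⟩, rfl⟩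
      rw [Measure.fst, Measure.snd, Measure.map_map measurable_fst measurable_snd]
      exact h2 n
    · rintro _ ⟨_, ⟨_, ⟨_, ⟨n, rfl⟩, rfl⟩, rfl⟩, rfl⟩
      rw [Measure.snd, Measure.snd, Measure.map_map measurable_snd measurable_snd]
      exact h3 n
  obtain ⟨ρ, -, j, hj, hlim⟩ := (isCompact_closure_of_isTightMeasureSet htight).isSeqCompact
    (x := P) fun n => subset_closure (mem_range_self n)
  refine ⟨j, hj, ρ, inferInstance, ?_⟩
  have d1 : Measurable fun p : Y × Y × Y => p.1 := by fun_prop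
  have d2 : Measurable fun p : Y × Y × Y => p.2.1 := by fun_prop
  have d3 : Measurable fun p : Y × Y × Y => p.2.2 := by fun_prop
  have l1 : (ρ : Measure (Y × Y × Y)).map (fun p => p.1) ≤ m :=
    map_le_of_tendsto hlim (by fun_prop) fun n => h1 (j n)
  have l2 : (ρ : Measure (Y × Y × Y)).map (fun p => p.2.1) ≤ m :=
    map_le_of_tendsto hlim (by fun_prop) fun n => h2 (j n)
  have l3 : (ρ : Measure (Y × Y × Y)).map (fun p => p.2.2) ≤ m :=
    map_le_of_tendsto hlim (by fun_prop) fun n => h3 (j n)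
  set S : Set (Set Y) := {A | MeasurableSet A ∧ m (frontier A) = 0} with hS
  have hgen := generateFrom_null_frontier m
  have hpi := isPiSystem_null_frontier m
  have huniv : (univ : Set Y) ∈ S := ⟨.univ, by simp⟩
  -- Since the marginals of the limit are dominated by `m`, boxes with sides in `S` are continuity
  -- sets of `ρ`.
  have null : ∀ {g : Y × Y × Y → Y}, Measurable g → (ρ : Measure (Y × Y × Y)).map g ≤ m →
      ∀ A ∈ S, (ρ : Measure (Y × Y × Y)) (g ⁻¹' frontier A) = 0 := by
    intro g hg hle A hA
    rw [← Measure.map_apply hg isClosed_frontier.measurableSet]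
    exact le_antisymm ((hle _).trans hA.2.le) zero_le
  have b1 : ∀ A ∈ S, ∀ B ∈ S, ∀ C ∈ S,
      Tendsto (fun n => ρs (j n) (A ×ˢ B ×ˢ C)) atTop 
        (𝓝 ((ρ : Measure (Y × Y × Y)) (A ×ˢ B ×ˢ C))) := by
    intro A hA B hB C hC
    have := ProbabilityMeasure.tendsto_measure_of_null_frontier_of_tendsto' hlim
      (E := A ×ˢ B ×ˢ C) (measure_mono_null (t := (fun p : Y × Y × Y => p.1) ⁻¹' frontier A ∪
        ((fun p : Y × Y × Y => p.2.1) ⁻¹' frontier B ∪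
          (fun p : Y × Y × Y => p.2.2) ⁻¹' frontier C)) ?_
        (measure_union_null (null d1 l1 A hA)
          (measure_union_null (null d2 l2 B hB) (null d3 l3 C hC))))
    · exact this
    · rintro ⟨x, y, z⟩ h
      simp only [frontier_prod_eq, mem_union, mem_prod] at h
      simp only [mem_union, mem_preimage]
      tauto
  -- The three sides are freed from `S` one after the other, each time by domination of the
  -- corresponding marginal.
  have e1 : ∀ A B C : Set Y, (A ×ˢ B ×ˢ C : Set (Y × Y × Y)) =
      (fun p => p.1) ⁻¹' A ∩ univ ×ˢ B ×ˢ C := fun A B C => by ext; simp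
  have e2 : ∀ A B C : Set Y, (A ×ˢ B ×ˢ C : Set (Y × Y × Y)) =
      (fun p => p.2.1) ⁻¹' B ∩ A ×ˢ univ ×ˢ C := fun A B C => by ext; simp; tauto
  have e3 : ∀ A B C : Set Y, (A ×ˢ B ×ˢ C : Set (Y × Y × Y)) =
      (fun p => p.2.2) ⁻¹' C ∩ A ×ˢ B ×ˢ univ := fun A B C => by ext; simp; tauto
  have b2 : ∀ A, MeasurableSet A → ∀ B ∈ S, ∀ C ∈ S,
      Tendsto (fun n => ρs (j n) (A ×ˢ B ×ˢ C)) atTop 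
        (𝓝 ((ρ : Measure (Y × Y × Y)) (A ×ˢ B ×ˢ C))) := by
    intro A hA B hB C hC
    rw [e1 A B C]
    refine tendsto_measure_preimage_inter d1 (fun n => h1 (j n)) l1 hgen hpi huniv
      (fun A' hA' => ?_) hA
    rw [← e1]
    exact b1 A' hA' B hB C hC
  have b3 : ∀ A, MeasurableSet A → ∀ B, MeasurableSet B → ∀ C ∈ S,
      Tendsto (fun n => ρs (j n) (A ×ˢ B ×ˢ C)) atTop 
        (𝓝 ((ρ : Measure (Y × Y × Y)) (A ×ˢ B ×ˢ C))) := by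
    intro A hA B hB C hC
    rw [e2 A B C]
    refine tendsto_measure_preimage_inter d2 (fun n => h2 (j n)) l2 hgen hpi huniv
      (fun B' hB' => ?_) hB
    rw [← e2]
    exact b2 A hA B' hB' C hC
  intro A B C hA hB hC
  rw [e3 A B C]
  refine tendsto_measure_preimage_inter d3 (fun n => h3 (j n)) l3 hgen hpi huniv
    (fun C' hC' => ?_) hC
  rw [← e3]
  exact b3 A hA B hB C' hC'

end Compactness

/-! ### Joinings -/

section Joinings

variable {Y : Type*} [MeasurableSpace Y] {Φ : ℝ → Y → Y} {m : Measure Y}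

theorem offDiagonal3_apply (hΦ : ∀ t, Measurable (Φ t)) (m : Measure Y) (t u : ℝ) {A B C : Set Y}
    (hA : MeasurableSet A) (hB : MeasurableSet B) (hC : MeasurableSet C) :
    offDiagonal3 Φ m t u (A ×ˢ B ×ˢ C) = m (Φ t ⁻¹' A ∩ (Φ u ⁻¹' B ∩ C)) := by
  have hF : Measurable fun y => (Φ t y, Φ u y, y) := by fun_prop
  rw [offDiagonal3, Measure.map_apply hF (hA.prod (hB.prod hC))]
  rfl

theorem map_offDiagonal3 {Z : Type*} [MeasurableSpace Z] (hΦ : ∀ t, Measurable (Φ t))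
    (m : Measure Y) (t u : ℝ) {g : Y × Y × Y → Z} (hg : Measurable g) :
    (offDiagonal3 Φ m t u).map g = m.map fun y => g (Φ t y, Φ u y, y) := by
  have hF : Measurable fun y => (Φ t y, Φ u y, y) := by fun_prop
  rw [offDiagonal3, Measure.map_map hg hF]
  rfl

theorem isJoining3_offDiagonal3 [IsProbabilityMeasure m]
    (hΦ : ∀ t, MeasurePreserving (Φ t) m m) (hcomm : ∀ s t y, Φ s (Φ t y) = Φ t (Φ s y))
    (t u : ℝ) : IsJoining3 Φ m (offDiagonal3 Φ m t u) := by
  have hm : ∀ t, Measurable (Φ t) := fun t => (hΦ t).measurable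
  refine ⟨?_, fun s => ?_, ?_, ?_, ?_⟩
  · exact Measure.isProbabilityMeasure_map
      ((hm t).prodMk ((hm u).prodMk measurable_id)).aemeasurable
  · rw [map_offDiagonal3 hm _ _ _ (by fun_prop)]
    simp only [hcomm s]
    have hF : Measurable fun y => (Φ t y, Φ u y, y) := by fun_prop
    calc m.map (fun y => (Φ t (Φ s y), Φ u (Φ s y), Φ s y))
        = (m.map (Φ s)).map (fun y => (Φ t y, Φ u y, y)) := by
          rw [Measure.map_map hF (hm s)]; rfl
      _ = offDiagonal3 Φ m t u := by rw [(hΦ s).map_eq]; rfl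
  · rw [map_offDiagonal3 hm _ _ _ (by fun_prop)]
    exact (hΦ t).map_eq
  · rw [map_offDiagonal3 hm _ _ _ (by fun_prop)]
    exact (hΦ u).map_eq
  · rw [map_offDiagonal3 hm _ _ _ (by fun_prop)]
    exact Measure.map_id

theorem measurable_offDiagonal3 [SFinite m] (hΦ : Measurable fun q : ℝ × Y => Φ q.1 q.2) :
    Measurable fun p : ℝ × ℝ => offDiagonal3 Φ m (-p.1) (-p.2) := by
  have hΦt : ∀ t, Measurable (Φ t) := fun t => hΦ.comp measurable_prodMk_left
  refine Measure.measurable_of_measurable_coe _ fun S hS => ?_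
  have hF : Measurable fun q : (ℝ × ℝ) × Y => (Φ (-q.1.1) q.2, Φ (-q.1.2) q.2, q.2) :=
    (hΦ.comp (by fun_prop : Measurable fun q : (ℝ × ℝ) × Y => (-q.1.1, q.2))).prodMk
      ((hΦ.comp (by fun_prop : Measurable fun q : (ℝ × ℝ) × Y => (-q.1.2, q.2))).prodMk
        measurable_snd)
  have := measurable_measure_prodMk_left (ν := m) (hF hS)
  convert! this using 2 with p
  rw [offDiagonal3, Measure.map_apply (by fun_prop) hS]
  rfl

theorem integralJoining3_apply [SFinite m] (hΦ : Measurable fun q : ℝ × Y => Φ q.1 q.2)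
    (P : Measure (ℝ × ℝ)) {S : Set (Y × Y × Y)} (hS : MeasurableSet S) :
    integralJoining3 Φ m P S = ∫⁻ p, offDiagonal3 Φ m (-p.1) (-p.2) S ∂P :=
  Measure.bind_apply hS (measurable_offDiagonal3 hΦ).aemeasurable

theorem map_integralJoining3 [SFinite m] {Z : Type*} [MeasurableSpace Z]
    (hΦ : Measurable fun q : ℝ × Y => Φ q.1 q.2) (P : Measure (ℝ × ℝ)) [IsProbabilityMeasure P]
    {g : Y × Y × Y → Z} (hg : Measurable g) {κ : Measure Z}
    (h : ∀ t u, (offDiagonal3 Φ m t u).map g = κ) : (integralJoining3 Φ m P).map g = κ := by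
  ext S hS
  rw [Measure.map_apply hg hS, integralJoining3_apply hΦ P (hg hS)]
  simp [← Measure.map_apply hg hS, h]

theorem isJoining3_integralJoining3 [IsProbabilityMeasure m]
    (hΦ : Measurable fun q : ℝ × Y => Φ q.1 q.2) (hΦm : ∀ t, MeasurePreserving (Φ t) m m)
    (hcomm : ∀ s t y, Φ s (Φ t y) = Φ t (Φ s y)) (P : Measure (ℝ × ℝ)) [IsProbabilityMeasure P] :
    IsJoining3 Φ m (integralJoining3 Φ m P) := by
  have hj := isJoining3_offDiagonal3 hΦm hcomm
  have hm : ∀ t, Measurable (Φ t) := fun t => (hΦm t).measurable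
  refine ⟨⟨?_⟩, fun s => ?_, map_integralJoining3 hΦ P (by fun_prop) fun t u => (hj t u).proj_one,
    map_integralJoining3 hΦ P (by fun_prop) fun t u => (hj t u).proj_two,
    map_integralJoining3 hΦ P (by fun_prop) fun t u => (hj t u).proj_three⟩
  · rw [integralJoining3_apply hΦ P .univ]
    simp [fun t u => (hj t u).prob.measure_univ]
  · ext S hS
    have hg : Measurable fun p : Y × Y × Y => (Φ s p.1, Φ s p.2.1, Φ s p.2.2) := by fun_prop
    rw [Measure.map_apply hg hS, integralJoining3_apply hΦ P (hg hS),
      integralJoining3_apply hΦ P hS]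
    refine lintegral_congr fun p => ?_
    rw [← Measure.map_apply hg hS, (hj _ _).invariant s]

/-- A limit of joinings along all measurable boxes is a joining. -/
theorem IsJoining3.of_tendsto (hΦ : ∀ t, Measurable (Φ t)) {l : ℕ → Measure (Y × Y × Y)}
    {l' : Measure (Y × Y × Y)} (hl : ∀ n, IsJoining3 Φ m (l n))
    (h : ∀ A B C : Set Y, MeasurableSet A → MeasurableSet B → MeasurableSet C →
      Tendsto (fun n => l n (A ×ˢ B ×ˢ C)) atTop (𝓝 (l' (A ×ˢ B ×ˢ C)))) :
    IsJoining3 Φ m l' := by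
  have hprob : IsProbabilityMeasure l' := by
    refine ⟨tendsto_nhds_unique ?_ (tendsto_const_nhds (x := 1) (f := (atTop : Filter ℕ)))⟩
    have := h univ univ univ .univ .univ .univ
    simp only [univ_prod_univ] at this
    exact this.congr fun n => (hl n).prob.measure_univ
  refine ⟨hprob, fun t => ?_, ?_, ?_, ?_⟩
  · have hg : Measurable fun p : Y × Y × Y => (Φ t p.1, Φ t p.2.1, Φ t p.2.2) := by fun_prop
    have : IsProbabilityMeasure (l'.map fun p : Y × Y × Y => (Φ t p.1, Φ t p.2.1, Φ t p.2.2)) :=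
      Measure.isProbabilityMeasure_map hg.aemeasurable
    refine Measure.ext_prod₃ fun {A B C} hA hB hC => ?_
    rw [Measure.map_apply hg (hA.prod (hB.prod hC))]
    refine tendsto_nhds_unique (h _ _ _ (hΦ t hA) (hΦ t hB) (hΦ t hC)) ?_
    refine (h A B C hA hB hC).congr fun n => ?_
    conv_lhs => rw [← (hl n).invariant t]
    rw [Measure.map_apply hg (hA.prod (hB.prod hC))]
    rfl
  · ext A hA
    rw [Measure.map_apply measurable_fst hA]
    have := h A univ univ hA .univ .univ
    rw [univ_prod_univ, prod_univ] at this
    refine tendsto_nhds_unique this (tendsto_const_nhds.congr fun n => ?_)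
    conv_lhs => rw [← (hl n).proj_one]
    exact Measure.map_apply measurable_fst hA
  · ext A hA
    have hg : Measurable fun p : Y × Y × Y => p.2.1 := by fun_prop
    rw [Measure.map_apply hg hA]
    have := h univ A univ .univ hA .univ
    rw [univ_prod, prod_univ] at this
    refine tendsto_nhds_unique this (tendsto_const_nhds.congr fun n => ?_)
    conv_lhs => rw [← (hl n).proj_two]
    exact Measure.map_apply hg hA
  · ext A hA
    have hg : Measurable fun p : Y × Y × Y => p.2.2 := by fun_prop
    rw [Measure.map_apply hg hA]
    have := h univ univ A .univ .univ hA
    rw [univ_prod, univ_prod] at this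
    refine tendsto_nhds_unique this (tendsto_const_nhds.congr fun n => ?_)
    conv_lhs => rw [← (hl n).proj_three]
    exact Measure.map_apply hg hA

/-- From `a κ + b κ' = κ = a κ + b κ` the finite term `a κ` cancels, and then `b`. -/
theorem map_eq_of_convex_combination {Y Z : Type*} [MeasurableSpace Y] [MeasurableSpace Z]
    {l₁ l₂ : Measure Y} {a b : ENNReal} (hab : a + b = 1) (hb : b ≠ 0) {g : Y → Z} {κ : Measure Z}
    [IsFiniteMeasure κ] (hg : Measurable g) (h : (a • l₁ + b • l₂).map g = κ)
    (h₁ : l₁.map g = κ) : l₂.map g = κ := by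
  have ha' : a ≠ ⊤ := fun h => by simp [h] at hab
  have hb' : b ≠ ⊤ := fun h => by simp [h] at hab
  rw [Measure.map_add _ _ hg, Measure.map_smul, Measure.map_smul, h₁] at h
  ext S hS
  have e := congrArg (fun κ' : Measure Z => κ' S) h
  simp only [Measure.add_apply, Measure.smul_apply, smul_eq_mul] at e
  have e' : κ S = a * κ S + b * κ S := by rw [← add_mul, hab, one_mul]
  conv_rhs at e => rw [e']
  rwa [ENNReal.add_right_inj (ENNReal.mul_ne_top ha' (measure_ne_top _ _)),
    ENNReal.mul_right_inj hb hb'] at e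

/-- If a joining is a convex combination of a joining and a probability measure, with a positive
weight on the latter, then the latter is a joining. -/
theorem IsJoining3.of_convex_combination (hΦ : ∀ t, Measurable (Φ t)) [IsProbabilityMeasure m]
    {l₁ l₂ : Measure (Y × Y × Y)} [IsProbabilityMeasure l₂] {a b : ENNReal} (hab : a + b = 1)
    (hb : b ≠ 0) (h₁ : IsJoining3 Φ m l₁) (h : IsJoining3 Φ m (a • l₁ + b • l₂)) :
    IsJoining3 Φ m l₂ := by
  refine ⟨inferInstance, fun t => ?_,
    map_eq_of_convex_combination hab hb (by fun_prop) h.proj_one h₁.proj_one,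
    map_eq_of_convex_combination hab hb (by fun_prop) h.proj_two h₁.proj_two,
    map_eq_of_convex_combination hab hb (by fun_prop) h.proj_three h₁.proj_three⟩
  have hg : Measurable fun p : Y × Y × Y => (Φ t p.1, Φ t p.2.1, Φ t p.2.2) := by fun_prop
  have hinv := h.invariant t
  rw [Measure.map_add _ _ hg, Measure.map_smul, Measure.map_smul, h₁.invariant t] at hinv
  have := h₁.prob
  have ha' : a ≠ ⊤ := fun h => by simp [h] at hab
  have hb' : b ≠ ⊤ := fun h => by simp [h] at hab
  ext S hS
  have e := congrArg (fun κ : Measure _ => κ S) hinv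
  simp only [Measure.add_apply, Measure.smul_apply, smul_eq_mul] at e
  rwa [ENNReal.add_right_inj (ENNReal.mul_ne_top ha' (measure_ne_top _ _)),
    ENNReal.mul_right_inj hb hb'] at e

end Joinings

/-! ### Asymptotically invariant functions -/

section Hilbert

variable {E : Type*} [NormedAddCommGroup E] [InnerProductSpace ℝ E]

/-- This allows weak convergence of a bounded sequence to be tested on a dense subset. -/
theorem isClosed_tendsto_inner_zero {K : ℕ → E} {C : ℝ} (hK : ∀ n, ‖K n‖ ≤ C) :
    IsClosed {v : E | Tendsto (fun n => inner ℝ (K n) v) atTop (𝓝 0)} := by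
  refine isClosed_of_closure_subset fun v hv => ?_
  have hC : 0 ≤ C := (norm_nonneg _).trans (hK 0)
  refine Metric.tendsto_atTop.2 fun ε hε => ?_
  -- `C + 1` instead of `C` keeps the denominator positive when `C = 0`.
  obtain ⟨w, hw, hvw⟩ := Metric.mem_closure_iff.1 hv (ε / (2 * (C + 1))) (by positivity)
  obtain ⟨N, hN⟩ := Metric.tendsto_atTop.1 hw (ε / 2) (by positivity)
  refine ⟨N, fun n hn => ?_⟩
  have h1 := hN n hn
  rw [Real.dist_eq, sub_zero] at h1 ⊢
  have h2 : inner ℝ (K n) v = inner ℝ (K n) w + inner ℝ (K n) (v - w) := by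
    rw [← inner_add_right, add_sub_cancel]
  have h3 : |inner ℝ (K n) (v - w)| ≤ C * (ε / (2 * (C + 1))) := by
    refine (abs_real_inner_le_norm _ _).trans ?_
    rw [dist_eq_norm] at hvw
    exact mul_le_mul (hK n) hvw.le (norm_nonneg _) hC
  have h4 : C * (ε / (2 * (C + 1))) ≤ ε / 2 := by
    rw [mul_div_assoc', div_le_div_iff₀ (by positivity) (by positivity)]
    nlinarith
  rw [h2]
  linarith [abs_add_le (inner ℝ (K n) w) (inner ℝ (K n) (v - w))]

/-- If the only vectors fixed by an isometry `U` are the multiples of `e`, then an asymptotically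
`U`-invariant bounded sequence is asymptotically weakly proportional to `e`. -/
theorem tendsto_inner_sub_of_isometry [CompleteSpace E] (U : E →ₗᵢ[ℝ] E) {e : E} (hUe : U e = e)
    (hU : ∀ v, U v = v → v = (inner ℝ e v : ℝ) • e) {H : ℕ → E} {C : ℝ} (hC : ∀ n, ‖H n‖ ≤ C)
    (hH : Tendsto (fun n => U (H n) - H n) atTop (𝓝 0)) (v : E) :
    Tendsto (fun n => inner ℝ (H n) v - inner ℝ (H n) e * inner ℝ e v) atTop (𝓝 0) := by
  have hC0 : 0 ≤ C := (norm_nonneg _).trans (hC 0)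
  set K : ℕ → E := fun n => H n - (inner ℝ (H n) e : ℝ) • e with hKdef
  have hin : ∀ n w, inner ℝ (K n) w = inner ℝ (H n) w - inner ℝ (H n) e * inner ℝ e w := by
    intro n w
    rw [hKdef, inner_sub_left, real_inner_smul_left]
  have hK : ∀ n, ‖K n‖ ≤ C + C * ‖e‖ * ‖e‖ := by
    intro n
    refine (norm_sub_le _ _).trans (add_le_add (hC n) ?_)
    rw [norm_smul]
    refine mul_le_mul_of_nonneg_right ?_ (norm_nonneg _)
    exact (abs_real_inner_le_norm _ _).trans (mul_le_mul_of_nonneg_right (hC n) (norm_nonneg _))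
  simp_rw [← hin]
  -- Von Neumann's splitting: the closure of the range of `U - 1`, and its orthogonal complement,
  -- whose vectors are fixed by `U`.
  let D : E →ₗ[ℝ] E := U.toLinearMap - LinearMap.id
  have hD : ∀ x, D x = U x - x := fun x => rfl
  let L : Submodule ℝ E := (LinearMap.range D).topologicalClosure
  have hL : IsClosed (L : Set E) := Submodule.isClosed_topologicalClosure _
  have : CompleteSpace L := hL.completeSpace_coe
  obtain ⟨y, hy, z, hz, rfl⟩ := Submodule.exists_add_mem_mem_orthogonal (K := L) v
  have h1 : Tendsto (fun n => inner ℝ (K n) y) atTop (𝓝 0) := by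
    refine closure_minimal (s := (LinearMap.range D : Set E)) ?_
      (isClosed_tendsto_inner_zero hK) hy
    rintro _ ⟨x, rfl⟩
    -- As `U` is an isometry, `⟨H, Ux - x⟩ = ⟨H, Ux⟩ - ⟨UH, Ux⟩`; the component along `e` drops out
    -- because `e` is fixed.
    have hx : ∀ n, inner ℝ (K n) (D x) =
        -inner ℝ (U (H n) - H n) (U x) := by
      intro n
      have e1 : inner ℝ e (U x) = inner ℝ e x := by
        conv_lhs => rw [← hUe, U.inner_map_map]
      simp only [hin, hD, inner_sub_right, inner_sub_left, U.inner_map_map, e1]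
      ring
    simp only [mem_ofPred_eq, hx]
    have := (hH.inner (𝕜 := ℝ) (tendsto_const_nhds (x := U x))).neg
    simpa using this
  have h2 : ∀ n, inner ℝ (K n) z = 0 := by
    -- If `z ⊥ Uz - z`, then `‖Uz - z‖² = 2‖z‖² - 2⟨Uz, z⟩ = 0`.
    have hzU : U z = z := by
      have h0 : inner ℝ (D z) z = (0 : ℝ) :=
        hz _ (Submodule.le_topologicalClosure _ ⟨z, rfl⟩)
      simp only [hD, inner_sub_left] at h0
      rw [← sub_eq_zero, ← norm_eq_zero, ← sq_eq_zero_iff, norm_sub_sq_real, U.norm_map]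
      rw [real_inner_self_eq_norm_sq] at h0
      linarith
    intro n
    have := hU z hzU
    rw [hin]
    conv_lhs => enter [1]; rw [this]
    rw [inner_smul_right]
    ring
  simp_rw [inner_add_right, h2, add_zero]
  exact h1

end Hilbert

/-! ### Ergodicity and asymptotic independence -/

section Ergodic

variable {X : Type*} [MeasurableSpace X] {μ : Measure X} [IsProbabilityMeasure μ]

/-- This is `tendsto_inner_sub_of_isometry` for the Koopman operator on `L²` with `e = 1`: by
ergodicity its fixed vectors are the constants. -/
theorem tendsto_setIntegral_sub_of_asymptotically_invariant {T : X → X} (hT : Ergodic T μ)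
    {h : ℕ → X → ℝ} (hm : ∀ n, Measurable (h n)) {C : ℝ} (hC : ∀ n x, |h n x| ≤ C)
    (hinv : Tendsto (fun n => ∫ x, |h n (T x) - h n x| ∂μ) atTop (𝓝 0))
    {E : Set X} (hE : MeasurableSet E) :
    Tendsto (fun n => ∫ x in E, h n x ∂μ - (∫ x, h n x ∂μ) * μ.real E) atTop (𝓝 0) := by
  have hmp : MeasurePreserving T μ μ := hT.toMeasurePreserving
  have hLp : ∀ n, MemLp (h n) 2 μ := fun n =>
    MemLp.of_bound (hm n).aestronglyMeasurable C (ae_of_all _ fun x => hC n x)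
  let U : Lp ℝ 2 μ →ₗᵢ[ℝ] Lp ℝ 2 μ := Lp.compMeasurePreservingₗᵢ ℝ T hmp
  let ind : ∀ A : Set X, MeasurableSet A → Lp ℝ 2 μ := fun A hA =>
    indicatorConstLp 2 hA (measure_ne_top μ A) (1 : ℝ)
  have hin : ∀ n (A : Set X) (hA : MeasurableSet A),
      inner ℝ ((hLp n).toLp) (ind A hA) = ∫ x in A, h n x ∂μ := by
    intro n A hA
    rw [real_inner_comm, L2.inner_indicatorConstLp_one]
    exact setIntegral_congr_ae hA ((hLp n).coeFn_toLp.mono fun x hx _ => hx)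
  have huniv : ∀ A (hA : MeasurableSet A), inner ℝ (ind univ .univ) (ind A hA) = μ.real A := by
    intro A hA
    rw [real_inner_comm, L2.inner_indicatorConstLp_one]
    rw [setIntegral_congr_ae (g := fun _ => (1 : ℝ)) hA]
    · simp
    · filter_upwards [indicatorConstLp_coeFn (p := 2) (hs := MeasurableSet.univ)
        (hμs := measure_ne_top μ univ) (c := (1 : ℝ))] with x hx _
      rw [hx]; simp
  have hone : ∀ᵐ x ∂μ, ind univ .univ x = (1 : ℝ) := by
    filter_upwards [indicatorConstLp_coeFn (p := 2) (hs := MeasurableSet.univ)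
        (hμs := measure_ne_top μ univ) (c := (1 : ℝ))] with x hx
    rw [hx]; simp
  have key := tendsto_inner_sub_of_isometry U (e := ind univ .univ) ?_ ?_
    (H := fun n => (hLp n).toLp) (C := C) ?_ ?_ (ind E hE)
  · simpa only [hin, huniv, Measure.restrict_univ] using key
  · refine Lp.ext ?_
    filter_upwards [Lp.coeFn_compMeasurePreserving (ind univ .univ) hmp, hone,
      hmp.quasiMeasurePreserving.ae hone] with x h1 h2 h3
    rw [h2, show U (ind univ .univ) x = _ from h1, Function.comp_apply, h3]
  · intro v hv
    have hvT : v ∘ T =ᵐ[μ] v := by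
      have h1 := Lp.coeFn_compMeasurePreserving v hmp
      rw [show Lp.compMeasurePreserving T hmp v = v from hv] at h1
      exact h1.symm
    obtain ⟨c, hc⟩ := hT.ae_eq_const_of_ae_eq_comp_ae (Lp.aestronglyMeasurable v) hvT
    have hinner : inner ℝ (ind univ .univ) v = c := by
      rw [L2.inner_indicatorConstLp_one, integral_congr_ae (ae_restrict_of_ae hc)]
      simp
    rw [hinner]
    refine Lp.ext ?_
    filter_upwards [hc, hone, Lp.coeFn_smul c (ind univ .univ)] with x h1 h2 h3
    rw [h1, h3, Pi.smul_apply, h2]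
    simp
  · intro n
    have hC0 : 0 ≤ C := (abs_nonneg _).trans (hC 0 (Classical.choice
      (nonempty_of_isProbabilityMeasure μ)))
    refine (Lp.norm_le_of_ae_bound (C := C) hC0 ?_).trans_eq (by simp [measureUnivNNReal])
    filter_upwards [(hLp n).coeFn_toLp] with x hx
    rw [hx]
    exact hC n x
  · rw [tendsto_zero_iff_norm_tendsto_zero]
    -- The uniform bound upgrades almost invariance in `L¹` to `L²`.
    have hsq : ∀ n, ‖U (hLp n).toLp - (hLp n).toLp‖ ^ 2 ≤
        2 * C * ∫ x, |h n (T x) - h n x| ∂μ := by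
      intro n
      rw [← real_inner_self_eq_norm_sq, L2.inner_def, ← integral_const_mul]
      have hae : ∀ᵐ x ∂μ, (U (hLp n).toLp - (hLp n).toLp : Lp ℝ 2 μ) x = h n (T x) - h n x := by
        filter_upwards [Lp.coeFn_sub (U (hLp n).toLp) (hLp n).toLp,
          Lp.coeFn_compMeasurePreserving (hLp n).toLp hmp, (hLp n).coeFn_toLp,
          hmp.quasiMeasurePreserving.ae (hLp n).coeFn_toLp] with x h1 h2 h3 h4
        rw [h1, Pi.sub_apply, show U (hLp n).toLp x = _ from h2, Function.comp_apply, h3, h4]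
      have hb : ∀ x, |h n (T x) - h n x| ≤ 2 * C := fun x => by
        linarith [abs_sub (h n (T x)) (h n x), hC n (T x), hC n x]
      refine integral_mono_of_nonneg (ae_of_all _ fun x => real_inner_self_nonneg) ?_ ?_
      · refine Integrable.const_mul ?_ _
        refine Integrable.of_bound (C := 2 * C) ?_ (ae_of_all _ fun x => ?_)
        · exact ((((hm n).comp hmp.measurable).sub (hm n)).abs).aestronglyMeasurable
        · rw [Real.norm_eq_abs, abs_abs]; exact hb x
      · filter_upwards [hae] with x hx
        rw [hx, real_inner_self_eq_norm_sq, Real.norm_eq_abs, sq]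
        exact mul_le_mul_of_nonneg_right (hb x) (abs_nonneg _)
    have hlim : Tendsto (fun n => ‖U (hLp n).toLp - (hLp n).toLp‖ ^ 2) atTop (𝓝 0) :=
      squeeze_zero (fun n => by positivity) hsq (by simpa using hinv.const_mul (2 * C))
    have := hlim.sqrt
    simpa [Real.sqrt_sq (norm_nonneg _)] using this

/-- If `f ∘ τₙ` and `f` fall asymptotically in the same level sets along `Vₙ`, then
`f ∘ τₙ - f → 0` in measure along `Vₙ`. -/
theorem tendsto_measure_dist_ge_of_rigid {τ : ℕ → X → X} {V : ℕ → Set X}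
    (hV : ∀ A : Set X, MeasurableSet A →
      Tendsto (fun n => μ (symmDiff (τ n ⁻¹' A) A ∩ V n)) atTop (𝓝 0))
    {f : X → ℝ} (hf : Measurable f) {δ : ℝ} (hδ : 0 < δ) :
    Tendsto (fun n => μ {x ∈ V n | δ ≤ |f (τ n x) - f x|}) atTop (𝓝 0) := by
  let A : ℤ → Set X := fun j => {x | ⌊f x / δ⌋ = j}
  have hA : ∀ j, MeasurableSet (A j) := fun j =>
    (hf.div_const δ).floor (measurableSet_singleton j)
  have hAd : Pairwise (Function.onFun Disjoint A) := fun i j hij =>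
    Set.disjoint_left.2 fun x hx hy => hij (hx.symm.trans hy)
  have hsum : ∑' j, μ (A j) ≠ ⊤ := by
    rw [← measure_iUnion hAd hA]; exact measure_ne_top _ _
  -- A point at which `f` changes by at least `δ` leaves its level set of width `δ`. Intersecting
  -- with `A j` provides the summable bound `μ (A j)` for dominated convergence.
  have hle : ∀ n, μ {x ∈ V n | δ ≤ |f (τ n x) - f x|} ≤
      ∑' j, μ (A j ∩ (symmDiff (τ n ⁻¹' A j) (A j) ∩ V n)) := by
    intro n
    refine (measure_mono ?_).trans (measure_iUnion_le _)
    rintro x ⟨hxV, hx⟩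
    refine mem_iUnion.2 ⟨⌊f x / δ⌋, rfl, Or.inr ⟨rfl, fun h => ?_⟩, hxV⟩
    have h' : ⌊f (τ n x) / δ⌋ = ⌊f x / δ⌋ := h
    have := Int.abs_sub_lt_one_of_floor_eq_floor h'
    rw [← sub_div, abs_div, abs_of_pos hδ, div_lt_one hδ] at this
    exact absurd hx (not_le.2 this)
  refine tendsto_of_tendsto_of_tendsto_of_le_of_le tendsto_const_nhds ?_ (fun n => zero_le) hle
  rw [show (0 : ENNReal) = ∑' _ : ℤ, (0 : ENNReal) by simp]
  simp_rw [← lintegral_count]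
  refine tendsto_lintegral_of_dominated_convergence (fun j => μ (A j))
    (fun n => measurable_from_top) (fun n => ae_of_all _ fun j => measure_mono inter_subset_left)
    (by rwa [lintegral_count]) (ae_of_all _ fun j => ?_)
  exact tendsto_of_tendsto_of_tendsto_of_le_of_le tendsto_const_nhds (hV (A j) (hA j))
    (fun n => zero_le) fun n => measure_mono inter_subset_right

/-- Asymptotic independence: along almost invariant sets, almost invariant maps to a compact space
become independent of every event. -/
theorem tendsto_setIntegral_inter_of_almost_invariant {K : Type*} [PseudoMetricSpace K]
    [CompactSpace K] [MeasurableSpace K] [BorelSpace K] {T : X → X} (hT : Ergodic T μ)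
    {V : ℕ → Set X} (hV : ∀ n, MeasurableSet (V n))
    (hVT : Tendsto (fun n => μ (symmDiff (V n) (T ⁻¹' V n))) atTop (𝓝 0))
    {w : ℕ → X → K} (hw : ∀ n, Measurable (w n))
    (hwT : ∀ δ > 0, Tendsto (fun n => μ {x ∈ V n | δ ≤ dist (w n (T x)) (w n x)}) atTop (𝓝 0))
    (c : C(K, ℝ)) {l : ℝ} (hl : Tendsto (fun n => ∫ x in V n, c (w n x) ∂μ) atTop (𝓝 l))
    {E : Set X} (hE : MeasurableSet E) :
    Tendsto (fun n => ∫ x in V n ∩ E, c (w n x) ∂μ) atTop (𝓝 (l * μ.real E)) := by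
  -- Cut off to `V n`, the observable changes under `T` only slightly, except where the orbit
  -- crosses the boundary of `V n` (`S₁`) or `w n` jumps by `δ` (`S₂`).
  let h : ℕ → X → ℝ := fun n => (V n).indicator fun x => c (w n x)
  have hm : ∀ n, Measurable (h n) := fun n =>
    (c.continuous.measurable.comp (hw n)).indicator (hV n)
  have hc : ∀ z, |c z| ≤ ‖c‖ := fun z => c.norm_coe_le_norm z
  have hb : ∀ n x, |h n x| ≤ ‖c‖ := by
    intro n x
    by_cases hx : x ∈ V n
    · simpa [h, hx] using hc (w n x)
    · simp [h, hx]
  have hinv : Tendsto (fun n => ∫ x, |h n (T x) - h n x| ∂μ) atTop (𝓝 0) := by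
    refine Metric.tendsto_atTop.2 fun ε hε => ?_
    obtain ⟨δ, hδ, hcδ⟩ := Metric.uniformContinuous_iff.1
      (CompactSpace.uniformContinuous_of_continuous c.continuous) (ε / 2) (by positivity)
    have hlim : Tendsto (fun n => ε / 2 + 2 * ‖c‖ *
        (μ.real (symmDiff (V n) (T ⁻¹' V n)) + μ.real {x ∈ V n | δ ≤ dist (w n (T x)) (w n x)}))
        atTop (𝓝 (ε / 2 + 2 * ‖c‖ * (0 + 0))) :=
      (((((ENNReal.tendsto_toReal ENNReal.zero_ne_top).comp hVT).add
        ((ENNReal.tendsto_toReal ENNReal.zero_ne_top).comp (hwT δ hδ))).const_mul _).const_add _)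
    obtain ⟨N, hN⟩ := (hlim.eventually (gt_mem_nhds (show ε / 2 + 2 * ‖c‖ * (0 + 0) < ε by
      simp; linarith))).exists_forall_of_atTop
    refine ⟨N, fun n hn => ?_⟩
    rw [Real.dist_eq, sub_zero, abs_of_nonneg (integral_nonneg fun x => abs_nonneg _)]
    refine lt_of_le_of_lt ?_ (hN n hn)
    set S₁ := symmDiff (V n) (T ⁻¹' V n)
    set S₂ := {x ∈ V n | δ ≤ dist (w n (T x)) (w n x)}
    have hTm := hT.measurable
    have hS₁ : MeasurableSet S₁ := (hV n).symmDiff (hTm (hV n))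
    have hS₂ : MeasurableSet S₂ := by
      have := EMetric.secondCountable_of_sigmaCompact K
      exact (hV n).inter (measurableSet_le measurable_const (((hw n).comp hTm).dist (hw n)))
    have hpt : ∀ x, |h n (T x) - h n x| ≤
        ε / 2 + (S₁.indicator (fun _ => 2 * ‖c‖) x + S₂.indicator (fun _ => 2 * ‖c‖) x) := by
      intro x
      have htriv : |h n (T x) - h n x| ≤ 2 * ‖c‖ := by
        linarith [abs_sub (h n (T x)) (h n x), hb n (T x), hb n x]
      have hn1 : 0 ≤ S₁.indicator (fun _ => 2 * ‖c‖) x :=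
        indicator_nonneg (fun _ _ => by positivity) x
      have hn2 : 0 ≤ S₂.indicator (fun _ => 2 * ‖c‖) x :=
        indicator_nonneg (fun _ _ => by positivity) x
      by_cases h1 : x ∈ S₁
      · rw [indicator_of_mem h1]; linarith
      by_cases h2 : x ∈ S₂
      · rw [indicator_of_mem h2]; linarith
      by_cases hx : x ∈ V n
      · have hTx : T x ∈ V n := by
          by_contra hTx
          exact h1 (Or.inl ⟨hx, hTx⟩)
        have hd : dist (w n (T x)) (w n x) < δ := by
          by_contra hd
          exact h2 ⟨hx, not_lt.1 hd⟩
        have := hcδ hd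
        rw [Real.dist_eq] at this
        simp only [h, indicator_of_mem hx, indicator_of_mem hTx]
        linarith
      · have hTx : T x ∉ V n := fun hTx => h1 (Or.inr ⟨hTx, hx⟩)
        simp only [h, indicator_of_notMem hx, indicator_of_notMem hTx, sub_zero, abs_zero]
        linarith
    have hi : Integrable (fun x => S₁.indicator (fun _ => 2 * ‖c‖) x +
        S₂.indicator (fun _ => 2 * ‖c‖) x) μ :=
      ((integrable_const _).indicator hS₁).add ((integrable_const _).indicator hS₂)
    refine (integral_mono_of_nonneg (ae_of_all _ fun x => abs_nonneg _)
      ((integrable_const _).add hi) (ae_of_all _ hpt)).trans_eq ?_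
    rw [integral_add' (integrable_const _) hi, integral_add ((integrable_const _).indicator hS₁)
      ((integrable_const _).indicator hS₂), integral_indicator hS₁, integral_indicator hS₂]
    simp
    ring
  have key := tendsto_setIntegral_sub_of_asymptotically_invariant hT hm hb hinv hE
  have e1 : ∀ n, ∫ x, h n x ∂μ = ∫ x in V n, c (w n x) ∂μ := fun n => integral_indicator (hV n)
  have e2 : ∀ n, ∫ x in E, h n x ∂μ = ∫ x in V n ∩ E, c (w n x) ∂μ := fun n => by
    rw [integral_indicator (hV n), Measure.restrict_restrict (hV n)]
  simp_rw [e1, e2] at key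
  simpa using key.add (hl.mul_const (μ.real E))

end Ergodic

/-! ### Limits by uniform approximation -/

section Approximation

theorem tendsto_of_forall_approx {a : ℕ → ℝ} {l : ℝ}
    (h : ∀ ε > 0, ∃ (b : ℕ → ℝ) (l' : ℝ), Tendsto b atTop (𝓝 l') ∧
      (∀ᶠ n in atTop, |a n - b n| ≤ ε) ∧ |l' - l| ≤ ε) : Tendsto a atTop (𝓝 l) := by
  refine Metric.tendsto_atTop'.2 fun ε hε => ?_
  obtain ⟨b, l', hb, hab, hl⟩ := h (ε / 4) (by positivity)
  have hb' := hb.eventually (Metric.ball_mem_nhds l' (show 0 < ε / 4 by positivity))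
  obtain ⟨N, hN⟩ := (hab.and hb').exists_forall_of_atTop
  refine ⟨N, fun n hn => ?_⟩
  obtain ⟨h1, h2⟩ := hN n hn.le
  rw [Real.dist_eq, abs_lt] at h2 ⊢
  rw [abs_le] at h1 hl
  constructor <;> linarith [h1.1, h1.2, hl.1, hl.2, h2.1, h2.2]

end Approximation

/-! ### Carathéodory integrands -/

section Caratheodory

variable {X : Type*} [MeasurableSpace X] {K : Type*} [MetricSpace K] [CompactSpace K]

/-- Evaluation at a countable dense set is a continuous injection of the Polish space `C(K, ℝ)` into
a countable product, hence a measurable embedding by Lusin–Souslin. Carathéodory integrands thus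
become Bochner integrable functions. -/
theorem stronglyMeasurable_continuousMap {Γ : X → C(K, ℝ)} (h : ∀ z, Measurable fun x => Γ x z) :
    StronglyMeasurable Γ := by
  borelize C(K, ℝ)
  obtain ⟨D, hDc, hD⟩ := TopologicalSpace.exists_countable_dense K
  have : Countable D := hDc.to_subtype
  let e : C(K, ℝ) → (D → ℝ) := fun c d => c d
  have he : Continuous e := continuous_pi fun d => continuous_eval_const d.1
  have hinj : Function.Injective e := by
    intro c c' hcc
    refine DFunLike.coe_injective (Continuous.ext_on hD c.continuous c'.continuous fun d hd => ?_)
    exact congrFun hcc ⟨d, hd⟩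
  have hme : MeasurableEmbedding e := he.measurableEmbedding hinj
  have hΓ : Measurable Γ := hme.measurable_comp_iff.1 (measurable_pi_iff.2 fun d => h d)
  exact hΓ.stronglyMeasurable

variable [MeasurableSpace K] [BorelSpace K]

theorem exists_integralCLM (β : Measure K) [IsFiniteMeasure β] :
    ∃ L : C(K, ℝ) →L[ℝ] ℝ, ∀ c, L c = ∫ z, c z ∂β := by
  have hi : ∀ c : C(K, ℝ), Integrable c β := fun c =>
    c.continuous.integrable_of_hasCompactSupport (HasCompactSupport.of_compactSpace _)
  let L : C(K, ℝ) →ₗ[ℝ] ℝ :=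
    { toFun := fun c => ∫ z, c z ∂β
      map_add' := fun c c' => integral_add (hi c) (hi c')
      map_smul' := fun r c => integral_const_mul r _ }
  refine ⟨L.mkContinuous (β.real univ) fun c => ?_, fun c => rfl⟩
  refine (norm_integral_le_of_norm_le_const (C := ‖c‖)
    (ae_of_all _ fun z => c.norm_coe_le_norm z)).trans_eq (mul_comm _ _)

/-- Convergence of the integrals of products extends to Carathéodory integrands. -/
theorem tendsto_setIntegral_caratheodory {μ : Measure X} [IsFiniteMeasure μ] {V : ℕ → Set X}
    {w : ℕ → X → K} (hw : ∀ n, Measurable (w n)) (β : Measure K) [IsFiniteMeasure β]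
    (h : ∀ (c : C(K, ℝ)) (E : Set X), MeasurableSet E →
      Tendsto (fun n => ∫ x in V n ∩ E, c (w n x) ∂μ) atTop (𝓝 ((∫ z, c z ∂β) * μ.real E)))
    {Γ : X → C(K, ℝ)} (hΓ : Integrable Γ μ) :
    Tendsto (fun n => ∫ x in V n, Γ x (w n x) ∂μ) atTop (𝓝 (∫ x, ∫ z, Γ x z ∂β ∂μ)) := by
  obtain ⟨L, hL⟩ := exists_integralCLM β
  have heval : ∀ n {Γ : X → C(K, ℝ)}, Integrable Γ μ → Integrable (fun x => Γ x (w n x)) μ := by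
    intro n Γ hΓ
    refine hΓ.norm.mono' ?_ (ae_of_all _ fun x => (Γ x).norm_coe_le_norm _)
    exact (continuous_eval (F := C(K, ℝ))).comp_aestronglyMeasurable
      (hΓ.aestronglyMeasurable.prodMk (hw n).aestronglyMeasurable)
  simp_rw [← hL]
  -- For `c` times the indicator of a set this is the hypothesis `h`. It passes to `L¹` limits
  -- because `|Γ x z| ≤ ‖Γ x‖` uniformly in `z`.
  refine Integrable.induction (P := fun Γ : X → C(K, ℝ) =>
    Tendsto (fun n => ∫ x in V n, Γ x (w n x) ∂μ) atTop (𝓝 (∫ x, L (Γ x) ∂μ))) ?_ ?_ ?_ ?_ hΓ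
  · intro c s hs _
    have e1 : ∀ n, ∫ x in V n, (s.indicator (fun _ => c) x) (w n x) ∂μ =
        ∫ x in V n ∩ s, c (w n x) ∂μ := by
      intro n
      rw [inter_comm, ← Measure.restrict_restrict hs, ← integral_indicator hs]
      refine integral_congr_ae (ae_of_all _ fun x => ?_)
      by_cases hx : x ∈ s <;> simp [hx]
    have e2 : ∫ x, L (s.indicator (fun _ => c) x) ∂μ = (∫ z, c z ∂β) * μ.real s := by
      rw [← hL, mul_comm, ← smul_eq_mul, ← integral_indicator_const _ hs]
      refine integral_congr_ae (ae_of_all _ fun x => ?_)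
      by_cases hx : x ∈ s <;> simp [hx]
    simp_rw [e1, e2]
    exact h c s hs
  · intro f g _ hf hg ihf ihg
    simp only [Pi.add_apply, ContinuousMap.add_apply, map_add]
    rw [integral_add (L.integrable_comp hf) (L.integrable_comp hg)]
    refine (ihf.add ihg).congr fun n => ?_
    rw [integral_add (heval n hf).integrableOn (heval n hg).integrableOn]
  · refine isClosed_of_closure_subset fun F hF => tendsto_of_forall_approx fun ε hε => ?_
    obtain ⟨G, hG, hFG⟩ := Metric.mem_closure_iff.1 hF (ε / (‖L‖ + 1)) (by positivity)
    have hFi := L1.integrable_coeFn F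
    have hGi := L1.integrable_coeFn G
    have hnorm : ∫ x, ‖F x - G x‖ ∂μ ≤ ε / (‖L‖ + 1) := by
      rw [dist_eq_norm, L1.norm_eq_integral_norm] at hFG
      refine le_trans (le_of_eq ?_) hFG.le
      refine integral_congr_ae ?_
      filter_upwards [Lp.coeFn_sub F G] with x hx
      rw [hx, Pi.sub_apply]
    have hε' : ε / (‖L‖ + 1) ≤ ε := div_le_self hε.le (by linarith [norm_nonneg L])
    refine ⟨_, _, hG, Eventually.of_forall fun n => ?_, ?_⟩
    · rw [← integral_sub (heval n hFi).integrableOn (heval n hGi).integrableOn]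
      refine (abs_integral_le_integral_abs).trans (le_trans ?_ (hnorm.trans hε'))
      refine le_trans ?_ (setIntegral_le_integral (s := V n) (hFi.sub hGi).norm
        (ae_of_all _ fun x => norm_nonneg _))
      refine integral_mono ((heval n hFi).sub (heval n hGi)).integrableOn.abs
        (hFi.sub hGi).norm.integrableOn fun x => ?_
      exact (F x - G x).norm_coe_le_norm (w n x)
    · rw [← integral_sub (L.integrable_comp hGi) (L.integrable_comp hFi)]
      refine (abs_integral_le_integral_abs).trans ?_
      have : ∀ x, |L (G x) - L (F x)| ≤ ‖L‖ * ‖F x - G x‖ := fun x => by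
        rw [← map_sub, norm_sub_rev]
        exact L.le_opNorm _
      refine (integral_mono ((L.integrable_comp hGi).sub (L.integrable_comp hFi)).abs
        ((hFi.sub hGi).norm.const_mul _) this).trans ?_
      rw [integral_const_mul]
      calc ‖L‖ * ∫ x, ‖F x - G x‖ ∂μ ≤ ‖L‖ * (ε / (‖L‖ + 1)) := by gcongr
        _ ≤ ε := by
          rw [mul_div_assoc', div_le_iff₀ (by positivity)]
          nlinarith [norm_nonneg L]
  · intro f g hfg _ ih
    rw [integral_congr_ae (hfg.mono fun x hx => congrArg L hx)] at ih
    refine ih.congr fun n => ?_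
    exact integral_congr_ae (ae_restrict_of_ae (hfg.mono fun x hx => by simp only [hx]))

end Caratheodory

/-! ### Rigidity in the fibres -/

section Fibres

variable {X : Type*} [MeasurableSpace X] {μ : Measure X}

theorem exists_measure_abs_gt_le [IsFiniteMeasure μ] {g : X → ℝ} (hg : Measurable g)
    {ε : ENNReal} (hε : 0 < ε) : ∃ M : ℝ, 0 ≤ M ∧ μ {x | M < |g x|} ≤ ε := by
  have h : Tendsto (fun k : ℕ => μ {x | (k : ℝ) < |g x|}) atTop
      (𝓝 (μ (⋂ k : ℕ, {x | (k : ℝ) < |g x|}))) := by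
    refine tendsto_measure_iInter_atTop
      (fun k => (measurableSet_lt measurable_const hg.abs).nullMeasurableSet) ?_
      ⟨0, measure_ne_top _ _⟩
    intro k l hkl x hx
    exact lt_of_le_of_lt (Nat.cast_le.2 hkl) (show (l : ℝ) < |g x| from hx)
  have h0 : (⋂ k : ℕ, {x | (k : ℝ) < |g x|}) = ∅ := by
    refine eq_empty_of_forall_notMem fun x hx => ?_
    obtain ⟨k, hk⟩ := exists_nat_gt |g x|
    exact lt_asymm hk (mem_iInter.1 hx k)
  rw [h0, measure_empty] at h
  obtain ⟨k, hk⟩ := (h.eventually (ge_mem_nhds hε)).exists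
  exact ⟨k, k.cast_nonneg, hk⟩

/-- If `τₙ` is asymptotically the identity along `Vₙ` and `zₙ` is tight along `Vₙ`, then the
sections over `τₙ x` and over `x`, translated by `zₙ x`, asymptotically agree over `[0, f x)`. -/
theorem tendsto_setLIntegral_fibre_of_rigid [IsFiniteMeasure μ] {τ : ℕ → X → X}
    (hτ : ∀ n, Measurable (τ n)) {V : ℕ → Set X} (hVm : ∀ n, MeasurableSet (V n))
    (hV : ∀ A : Set X, MeasurableSet A →
      Tendsto (fun n => μ (symmDiff (τ n ⁻¹' A) A ∩ V n)) atTop (𝓝 0))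
    {f : X → ℝ} (hf : Measurable f) (hfi : Integrable f μ)
    {z : ℕ → X → ℝ} (hz : ∀ n, Measurable (z n))
    (htight : ∀ ε : ENNReal, 0 < ε → ∃ M : ℝ, ∀ᶠ n in atTop, μ {x ∈ V n | M < |z n x|} ≤ ε)
    {U : Set (X × ℝ)} (hU : MeasurableSet U) :
    Tendsto (fun n => ∫⁻ x in V n, volume {r ∈ Ico 0 (f x) |
      ¬((τ n x, r - z n x) ∈ U ↔ (x, r - z n x) ∈ U)} ∂μ) atTop (𝓝 0) := by
  rw [ENNReal.tendsto_nhds_zero]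
  intro ε hε
  have hε2 : 0 < ε / 2 := ENNReal.half_pos hε.ne'
  -- Fibres are discarded where `z n` or `f` is large; their total length is small by absolute
  -- continuity of the integral of `f`.
  obtain ⟨δ, hδ, hfδ⟩ := exists_pos_setLIntegral_lt_of_measure_lt
    (f := fun x => ENNReal.ofReal (f x)) (μ := μ) hfi.lintegral_lt_top.ne hε2.ne'
  obtain ⟨η, hη, hηδ⟩ : ∃ η : ENNReal, 0 < η ∧ η + η < δ := by
    obtain ⟨η, h1, h2⟩ := exists_between hδ
    exact ⟨η / 2, ENNReal.half_pos h1.ne', by rwa [ENNReal.add_halves]⟩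
  obtain ⟨M₁, hM₁⟩ := htight η hη
  obtain ⟨M₂, -, hM₂⟩ := exists_measure_abs_gt_le (μ := μ) hf hη
  set M := max M₁ M₂
  let D : ℕ → Set (X × ℝ) := fun n => {p | ¬((τ n p.1, p.2) ∈ U ↔ p ∈ U)}
  have hD : ∀ n, MeasurableSet (D n) := by
    intro n
    have h1 : MeasurableSet {p : X × ℝ | (τ n p.1, p.2) ∈ U} :=
      (((hτ n).comp measurable_fst).prodMk measurable_snd) hU
    exact (h1.iff hU).compl
  -- This interval contains `r - z` whenever `0 ≤ r < f x ≤ M` and `|z| ≤ M`.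
  let I : Set ℝ := Icc (-M) (2 * M)
  have hsec : ∀ n s, μ (symmDiff (τ n ⁻¹' {x | (x, s) ∈ U}) {x | (x, s) ∈ U} ∩ V n) =
      μ.restrict (V n) ((fun x => (x, s)) ⁻¹' D n) := by
    intro n s
    rw [Measure.restrict_apply (measurable_prodMk_right (hD n))]
    congr 2
    ext x
    simp only [mem_symmDiff, mem_preimage, mem_ofPred_eq, D]
    tauto
  -- At each fixed height `s` rigidity applies to the horizontal section of `U`; Tonelli then
  -- returns to the fibres.
  have hlim : Tendsto (fun n => ∫⁻ s in I, μ (symmDiff (τ n ⁻¹' {x | (x, s) ∈ U})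
      {x | (x, s) ∈ U} ∩ V n)) atTop (𝓝 0) := by
    rw [show (0 : ENNReal) = ∫⁻ s in I, 0 by simp]
    refine tendsto_lintegral_of_dominated_convergence (fun _ => μ univ) (fun n => ?_)
      (fun n => ae_of_all _ fun s => measure_mono (subset_univ _)) ?_
      (ae_of_all _ fun s => hV _ (measurable_prodMk_right hU))
    · simp_rw [hsec]
      exact measurable_measure_prodMk_right (hD n)
    · rw [setLIntegral_const]
      exact ENNReal.mul_ne_top (measure_ne_top _ _) (by simp [I])
  have hTon : ∀ n, ∫⁻ s in I, μ (symmDiff (τ n ⁻¹' {x | (x, s) ∈ U}) {x | (x, s) ∈ U} ∩ V n) =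
      ∫⁻ x in V n, volume {s ∈ I | (x, s) ∈ D n} ∂μ := by
    intro n
    simp_rw [hsec]
    rw [← Measure.prod_apply_symm (ν := volume.restrict I) (hD n), Measure.prod_apply (hD n)]
    refine lintegral_congr fun x => ?_
    rw [Measure.restrict_apply (measurable_prodMk_left (hD n)), inter_comm]
    rfl
  filter_upwards [hM₁, ENNReal.tendsto_nhds_zero.1 hlim _ hε2] with n hn1 hn2
  rw [hTon] at hn2
  set B : Set X := {x ∈ V n | M₁ < |z n x|} ∪ {x | M₂ < |f x|}
  have hB : ∫⁻ x in B, ENNReal.ofReal (f x) ∂μ ≤ ε / 2 :=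
    (hfδ B ((measure_union_le _ _).trans_lt ((add_le_add hn1 hM₂).trans_lt hηδ))).le
  have hBm : MeasurableSet B :=
    ((hVm n).inter (measurableSet_lt measurable_const (hz n).abs)).union
      (measurableSet_lt measurable_const hf.abs)
  rw [← ENNReal.add_halves ε]
  refine le_trans ?_ (add_le_add hB hn2)
  rw [← lintegral_indicator hBm, ← lintegral_indicator (hVm n), ← lintegral_indicator (hVm n),
    ← lintegral_add_left (hf.ennreal_ofReal.indicator hBm)]
  refine lintegral_mono fun x => ?_
  by_cases hxV : x ∈ V n
  · by_cases hxB : x ∈ B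
    · rw [indicator_of_mem hxB, indicator_of_mem hxV]
      refine le_trans ?_ le_self_add
      refine (measure_mono (sep_subset _ _)).trans ?_
      rw [Real.volume_Ico, sub_zero]
    · rw [indicator_of_mem hxV, indicator_of_mem hxV]
      refine le_trans ?_ le_add_self
      have hz1 : |z n x| ≤ M :=
        le_trans (not_lt.1 fun h => hxB (Or.inl ⟨hxV, h⟩)) (le_max_left _ _)
      have hf1 : |f x| ≤ M := le_trans (not_lt.1 fun h => hxB (Or.inr h)) (le_max_right _ _)
      rw [abs_le] at hz1 hf1
      have hmI : MeasurableSet {s ∈ I | (x, s) ∈ D n} :=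
        measurableSet_Icc.inter (measurable_prodMk_left (hD n))
      rw [← (measurePreserving_sub_right volume (z n x)).measure_preimage hmI.nullMeasurableSet]
      refine measure_mono ?_
      rintro r ⟨⟨hr0, hr1⟩, hr⟩
      exact ⟨⟨by linarith, by linarith⟩, hr⟩
  · rw [indicator_of_notMem hxV]
    exact zero_le

/-- Translation is continuous in measure on sets of finite measure. As `S` may have infinite
measure, it is first cut to a window containing `r - t'` for all `r ∈ Q` and `|t' - t| < 1`. -/
theorem tendsto_volume_translate {S Q : Set ℝ} (hS : MeasurableSet S) {a b : ℝ} (hQ : Q ⊆ Icc a b)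
    (t : ℝ) :
    Tendsto (fun t' => volume {r ∈ Q | ¬(r - t' ∈ S ↔ r - t ∈ S)}) (𝓝 t) (𝓝 0) := by
  let S' := S ∩ Icc (a - |t| - 1) (b + |t| + 1)
  have hS' : MeasurableSet S' := hS.inter measurableSet_Icc
  let F : ℝ → C(ℝ, ℝ) := fun t' => ⟨fun r => r - t', by fun_prop⟩
  have hF : Continuous F := ContinuousMap.continuous_of_continuous_uncurry _ (by
    simp only [F, ContinuousMap.coe_mk, Function.uncurry_def]; fun_prop)
  have hmp : ∀ t', MeasurePreserving (F t') volume volume := fun t' =>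
    measurePreserving_sub_right volume t'
  have key := tendsto_measure_symmDiff_preimage_nhds_zero (hF.tendsto t)
    (Eventually.of_forall hmp) (hmp t) hS'.nullMeasurableSet
    (measure_ne_top_of_subset inter_subset_right (by simp))
  refine tendsto_of_tendsto_of_tendsto_of_le_of_le' tendsto_const_nhds key
    (Eventually.of_forall fun _ => zero_le) ?_
  filter_upwards [Metric.ball_mem_nhds t one_pos] with t' ht'
  refine measure_mono ?_
  rintro r ⟨hr, hne⟩
  have hr' := hQ hr
  rw [Real.ball_eq_Ioo, mem_Ioo] at ht'
  have h1 := neg_abs_le t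
  have h2 := le_abs_self t
  have m1 : r - t' ∈ Icc (a - |t| - 1) (b + |t| + 1) :=
    ⟨by linarith [hr'.1], by linarith [hr'.2]⟩
  have m2 : r - t ∈ Icc (a - |t| - 1) (b + |t| + 1) :=
    ⟨by linarith [hr'.1], by linarith [hr'.2]⟩
  have e1 : r ∈ F t' ⁻¹' S' ↔ r - t' ∈ S := ⟨fun h => h.1, fun h => ⟨h, m1⟩⟩
  have e2 : r ∈ F t ⁻¹' S' ↔ r - t ∈ S := ⟨fun h => h.1, fun h => ⟨h, m2⟩⟩
  rw [mem_symmDiff, e1, e2]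
  tauto

/-- The length of the overlap of translates of two subsets of the line depends continuously on the
translations. -/
theorem continuous_volume_translate_inter {S₁ S₂ Q : Set ℝ} (h₁ : MeasurableSet S₁)
    (h₂ : MeasurableSet S₂) (hQm : MeasurableSet Q) {a b : ℝ} (hQ : Q ⊆ Icc a b) :
    Continuous fun p : ℝ × ℝ =>
      volume.real {r ∈ Q | r - p.1 ∈ S₁ ∧ r - p.2 ∈ S₂} := by
  have hfin : ∀ R ⊆ Q, volume R ≠ ⊤ := fun R hR =>
    measure_ne_top_of_subset (hR.trans hQ) (by simp)
  have hm : ∀ p : ℝ × ℝ, MeasurableSet {r ∈ Q | r - p.1 ∈ S₁ ∧ r - p.2 ∈ S₂} := fun p =>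
    hQm.inter (((measurable_id.sub_const p.1) h₁).inter ((measurable_id.sub_const p.2) h₂))
  refine continuous_iff_continuousAt.2 fun p => ?_
  have k1 := ((ENNReal.tendsto_toReal ENNReal.zero_ne_top).comp
    ((tendsto_volume_translate h₁ hQ p.1).comp (continuous_fst.tendsto p)))
  have k2 := ((ENNReal.tendsto_toReal ENNReal.zero_ne_top).comp
    ((tendsto_volume_translate h₂ hQ p.2).comp (continuous_snd.tendsto p)))
  have k := k1.add k2
  simp only [ENNReal.toReal_zero, add_zero] at k
  refine tendsto_iff_dist_tendsto_zero.2 (squeeze_zero (fun _ => dist_nonneg) (fun p' => ?_) k)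
  rw [Real.dist_eq]
  refine (abs_measureReal_sub_le_measureReal_symmDiff' (hm p').nullMeasurableSet
    (hm p).nullMeasurableSet (hfin _ (sep_subset _ _)) (hfin _ (sep_subset _ _))).trans ?_
  refine le_trans ?_ (measureReal_union_le _ _)
  refine measureReal_mono ?_ (hfin _ (union_subset (sep_subset _ _) (sep_subset _ _)))
  intro r hr
  simp only [mem_symmDiff, mem_ofPred_eq, mem_union] at hr ⊢
  tauto

end Fibres

/-! ### Joint limits of the base point and the cocycles -/

section JointLimit

variable {X : Type*} [MeasurableSpace X] {μ : Measure X} [IsProbabilityMeasure μ]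
  {V : ℕ → Set X} {Z : ℕ → X → ℝ × ℝ} {α : ℝ} {P : Measure (ℝ × ℝ)} [IsProbabilityMeasure P]

theorem exists_tight_of_tendsto (hV : ∀ n, MeasurableSet (V n)) (hZ : ∀ n, Measurable (Z n))
    (hα0 : 0 ≤ α) (hα1 : α ≤ 1)
    (hlim : ∀ φ : ℝ × ℝ →ᵇ ℝ, Tendsto (fun n => ∫ x in V n, φ (Z n x) ∂μ) atTop
      (𝓝 (α * ∫ p, φ p ∂P))) {ε : ENNReal} (hε : 0 < ε) :
    ∃ M : ℝ, 0 ≤ M ∧ (∀ᶠ n in atTop, μ {x ∈ V n | M < ‖Z n x‖} ≤ ε) ∧ P {p | M < ‖p‖} ≤ ε := by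
  obtain ⟨η, hη0, hηε⟩ := exists_between hε
  have hηt : η ≠ ⊤ := (hηε.trans_le le_top).ne
  have hη' : 0 < η.toReal := ENNReal.toReal_pos hη0.ne' hηt
  obtain ⟨M, hM0, hM⟩ := exists_measure_abs_gt_le (μ := P) (g := fun p => ‖p‖) measurable_norm
    (ENNReal.half_pos hη0.ne')
  simp only [abs_norm] at hM
  -- This ramp lies between the indicators of `‖p‖ > M + 1` and `‖p‖ > M`, so the tail of `P`
  -- controls the tails of `Z n` through weak convergence.
  have hφc : Continuous fun p : ℝ × ℝ => min 1 (max 0 (‖p‖ - M)) := by fun_prop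
  have hφ0 : ∀ p : ℝ × ℝ, 0 ≤ min 1 (max 0 (‖p‖ - M)) := fun p =>
    le_min zero_le_one (le_max_left _ _)
  let φ : ℝ × ℝ →ᵇ ℝ := BoundedContinuousFunction.ofNormedAddCommGroup
    (fun p => min 1 (max 0 (‖p‖ - M))) hφc 1 fun p => by
      rw [Real.norm_eq_abs, abs_of_nonneg (hφ0 p)]; exact min_le_left _ _
  have hφ : ∀ p, φ p = min 1 (max 0 (‖p‖ - M)) := fun p => rfl
  have hms : MeasurableSet {p : ℝ × ℝ | M < ‖p‖} := measurableSet_lt measurable_const measurable_norm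
  have hφP : ∫ p, φ p ∂P ≤ η.toReal / 2 := by
    calc ∫ p, φ p ∂P ≤ ∫ p, {p : ℝ × ℝ | M < ‖p‖}.indicator (fun _ => (1 : ℝ)) p ∂P := by
          refine integral_mono (φ.integrable P) ((integrable_const _).indicator hms) fun p => ?_
          by_cases hp : M < ‖p‖
          · rw [indicator_of_mem (show p ∈ {p : ℝ × ℝ | M < ‖p‖} from hp), hφ]
            exact min_le_left _ _
          · rw [indicator_of_notMem (show p ∉ {p : ℝ × ℝ | M < ‖p‖} from hp), hφ]
            refine (min_le_right _ _).trans (max_le le_rfl ?_)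
            linarith [not_lt.1 hp]
      _ = P.real {p | M < ‖p‖} := integral_indicator_one hms
      _ ≤ η.toReal / 2 := by
          have := ENNReal.toReal_mono (ENNReal.div_ne_top hηt (by simp)) hM
          simpa [Measure.real] using this
  have hφα : α * ∫ p, φ p ∂P < η.toReal := by
    have h0 : 0 ≤ ∫ p, φ p ∂P := integral_nonneg hφ0
    nlinarith
  refine ⟨M + 1, by linarith, ?_, ?_⟩
  · filter_upwards [(hlim φ).eventually (gt_mem_nhds hφα)] with n hn
    have hmn : MeasurableSet {x ∈ V n | M + 1 < ‖Z n x‖} :=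
      (hV n).inter (measurableSet_lt measurable_const (hZ n).norm)
    have h1 : μ.real {x ∈ V n | M + 1 < ‖Z n x‖} ≤ ∫ x in V n, φ (Z n x) ∂μ := by
      rw [← integral_indicator_one hmn, ← integral_indicator (hV n)]
      refine integral_mono ((integrable_const _).indicator hmn) ?_ fun x => ?_
      · refine Integrable.indicator ?_ (hV n)
        exact Integrable.of_bound (φ.continuous.measurable.comp (hZ n)).aestronglyMeasurable ‖φ‖
          (ae_of_all _ fun x => φ.norm_coe_le_norm _)
      · by_cases hx : x ∈ {x ∈ V n | M + 1 < ‖Z n x‖}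
        · rw [indicator_of_mem hx, indicator_of_mem hx.1, hφ]
          refine le_min le_rfl (le_max_of_le_right ?_)
          have : M + 1 < ‖Z n x‖ := hx.2
          simp only [Pi.one_apply]
          linarith
        · rw [indicator_of_notMem hx]
          exact indicator_nonneg (fun y _ => hφ0 (Z n y)) x
    rw [← ENNReal.ofReal_toReal (measure_ne_top μ {x ∈ V n | M + 1 < ‖Z n x‖})]
    refine le_trans (ENNReal.ofReal_le_ofReal (h1.trans hn.le)) ?_
    rw [ENNReal.ofReal_toReal hηt]
    exact hηε.le
  · refine (measure_mono fun p (hp : M + 1 < ‖p‖) => ?_).trans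
      (hM.trans (ENNReal.half_le_self.trans hηε.le))
    exact (by linarith : M < ‖p‖)

/-- If `Zₙ` is almost `T`-invariant along the almost invariant sets `Vₙ` and its law there converges
to `P`, then the joint law of the base point and `Zₙ` converges to `μ ⊗ P` when tested against
Carathéodory integrands with an integrable bound. -/
theorem tendsto_setIntegral_of_caratheodory {T : X → X} (hT : Ergodic T μ)
    (hV : ∀ n, MeasurableSet (V n))
    (hVT : Tendsto (fun n => μ (symmDiff (V n) (T ⁻¹' V n))) atTop (𝓝 0))
    (hZ : ∀ n, Measurable (Z n))
    (hZT : ∀ δ > 0, Tendsto (fun n => μ {x ∈ V n | δ ≤ dist (Z n (T x)) (Z n x)}) atTop (𝓝 0))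
    (hα0 : 0 ≤ α) (hα1 : α ≤ 1)
    (hlim : ∀ φ : ℝ × ℝ →ᵇ ℝ, Tendsto (fun n => ∫ x in V n, φ (Z n x) ∂μ) atTop
      (𝓝 (α * ∫ p, φ p ∂P)))
    {f : X → ℝ} (hfi : Integrable f μ) {G : X → ℝ × ℝ → ℝ}
    (hGm : Measurable (Function.uncurry G)) (hGc : ∀ x, Continuous (G x))
    (hGf : ∀ x p, |G x p| ≤ f x) :
    Tendsto (fun n => ∫ x in V n, G x (Z n x) ∂μ) atTop (𝓝 (α * ∫ x, ∫ p, G x p ∂P ∂μ)) := by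
  have hf0 : ∀ x, 0 ≤ f x := fun x => (abs_nonneg _).trans (hGf x 0)
  refine tendsto_of_forall_approx fun ε hε => ?_
  have hI0 : 0 ≤ ∫ x, f x ∂μ := integral_nonneg hf0
  obtain ⟨δ, hδ, hfδ⟩ := exists_pos_setLIntegral_lt_of_measure_lt
    (f := fun x => ENNReal.ofReal (f x)) (μ := μ) (ε := ENNReal.ofReal (ε / 2))
    hfi.lintegral_lt_top.ne (ENNReal.ofReal_pos.2 (by positivity)).ne'
  obtain ⟨η₁, hη₁0, hη₁⟩ := exists_between hδ
  -- The first bound makes `f` small in mean where `Z n` is large, the second handles the tail of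
  -- `P`; the `+ 1` covers `∫ f = 0`.
  obtain ⟨M, hM0, hMμ, hMP⟩ := exists_tight_of_tendsto hV hZ hα0 hα1 hlim
    (ε := min η₁ (ENNReal.ofReal (ε / (2 * ∫ x, f x ∂μ + 1))))
    (lt_min hη₁0 (ENNReal.ofReal_pos.2 (by positivity)))
  have hMM : -M ≤ M := by linarith
  -- Clamping to a square makes the target compact. It is `1`-Lipschitz, so it keeps almost
  -- invariance, and it alters `G x p` only for `‖p‖ > M`, by at most `2 * f x`.
  let cl : ℝ × ℝ → Icc (-M) M × Icc (-M) M := fun p => (projIcc (-M) M hMM p.1, projIcc (-M) M hMM p.2)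
  have hcl : Continuous cl := by fun_prop
  let ι : Icc (-M) M × Icc (-M) M → ℝ × ℝ := fun k => (k.1, k.2)
  have hι : Continuous ι := by fun_prop
  have hιcl : ∀ p, ¬M < ‖p‖ → ι (cl p) = p := by
    intro p hp
    rw [not_lt, Prod.norm_def, sup_le_iff, Real.norm_eq_abs, Real.norm_eq_abs, abs_le, abs_le] at hp
    simp only [ι, cl, projIcc_of_mem hMM hp.1, projIcc_of_mem hMM hp.2]
  have hdist : ∀ p p', dist (cl p) (cl p') ≤ dist p p' := by
    intro p p'
    refine max_le_max ?_ ?_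
    · exact abs_projIcc_sub_projIcc hMM
    · exact abs_projIcc_sub_projIcc hMM
  let Γ : X → C(Icc (-M) M × Icc (-M) M, ℝ) := fun x => ⟨fun k => G x (ι k), (hGc x).comp hι⟩
  have hΓ : Integrable Γ μ := by
    refine hfi.mono' (stronglyMeasurable_continuousMap fun k => ?_).aestronglyMeasurable
      (ae_of_all _ fun x => (ContinuousMap.norm_le _ (hf0 x)).2 fun k => hGf x _)
    exact hGm.comp (measurable_id.prodMk measurable_const)
  let β : Measure (Icc (-M) M × Icc (-M) M) := ENNReal.ofReal α • P.map cl
  have hβ : ∀ c : C(Icc (-M) M × Icc (-M) M, ℝ), ∫ k, c k ∂β = α * ∫ p, c (cl p) ∂P := by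
    intro c
    rw [integral_smul_measure, ENNReal.toReal_ofReal hα0, smul_eq_mul,
      integral_map hcl.measurable.aemeasurable c.continuous.aestronglyMeasurable]
  have : IsProbabilityMeasure (P.map cl) :=
    Measure.isProbabilityMeasure_map hcl.measurable.aemeasurable
  have hβf : IsFiniteMeasure β := by
    refine ⟨?_⟩
    simp [β]
  have key := tendsto_setIntegral_caratheodory (μ := μ) (V := V) (w := fun n x => cl (Z n x))
    (fun n => hcl.measurable.comp (hZ n)) β (fun c E hE => ?_) hΓ
  · refine ⟨_, _, key, ?_, ?_⟩
    · filter_upwards [hMμ] with n hn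
      set B := {x ∈ V n | M < ‖Z n x‖}
      have hB : MeasurableSet B := (hV n).inter (measurableSet_lt measurable_const (hZ n).norm)
      have hi : ∀ g : X → ℝ × ℝ, Measurable g → Integrable (fun x => G x (g x)) μ := fun g hg =>
        hfi.mono' (hGm.comp (measurable_id.prodMk hg)).aestronglyMeasurable
          (ae_of_all _ fun x => hGf x _)
      have hi1 := hi (Z n) (hZ n)
      have hi2 := hi (fun x => ι (cl (Z n x))) (hι.measurable.comp (hcl.measurable.comp (hZ n)))
      have hfB : ∫ x in B, f x ∂μ ≤ ε / 2 := by
        rw [integral_eq_lintegral_of_nonneg_ae (ae_of_all _ hf0)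
          hfi.aestronglyMeasurable.restrict]
        refine ENNReal.toReal_le_of_le_ofReal (by positivity) (hfδ B ?_).le
        exact (hn.trans (min_le_left _ _)).trans_lt hη₁
      change |∫ x in V n, G x (Z n x) ∂μ - ∫ x in V n, G x (ι (cl (Z n x))) ∂μ| ≤ ε
      rw [← integral_sub hi1.integrableOn hi2.integrableOn]
      refine abs_integral_le_integral_abs.trans ?_
      calc ∫ x in V n, |G x (Z n x) - G x (ι (cl (Z n x)))| ∂μ
          ≤ ∫ x, B.indicator (fun x => 2 * f x) x ∂μ := by
            rw [← integral_indicator (hV n)]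
            refine integral_mono ((hi1.sub hi2).abs.indicator (hV n))
              ((hfi.const_mul 2).indicator hB) fun x => ?_
            by_cases hxV : x ∈ V n
            · by_cases hxB : x ∈ B
              · rw [indicator_of_mem hxV, indicator_of_mem hxB]
                linarith [abs_sub (G x (Z n x)) (G x (ι (cl (Z n x)))), hGf x (Z n x),
                  hGf x (ι (cl (Z n x)))]
              · rw [indicator_of_mem hxV, indicator_of_notMem hxB,
                  hιcl _ fun h => hxB ⟨hxV, h⟩, sub_self, abs_zero]
            · rw [indicator_of_notMem hxV]
              exact indicator_nonneg (fun y _ => by linarith [hf0 y]) x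
        _ = 2 * ∫ x in B, f x ∂μ := by rw [integral_indicator hB, integral_const_mul]
        _ ≤ ε := by linarith
    · have hbi : ∀ x (g : ℝ × ℝ → ℝ × ℝ), Continuous g → Integrable (fun p => G x (g p)) P :=
        fun x g hg => Integrable.of_bound ((hGc x).comp hg).aestronglyMeasurable (f x)
          (ae_of_all _ fun p => hGf x _)
      have hci : ∀ g : ℝ × ℝ → ℝ × ℝ, Measurable g →
          Integrable (fun x => ∫ p, G x (g p) ∂P) μ := by
        intro g hg
        refine hfi.mono' ?_ (ae_of_all _ fun x => ?_)
        · exact (StronglyMeasurable.integral_prod_right (f := fun x p => G x (g p))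
            (hGm.comp (measurable_fst.prodMk (hg.comp measurable_snd))).stronglyMeasurable
            ).aestronglyMeasurable
        · refine (norm_integral_le_of_norm_le_const (C := f x)
            (ae_of_all _ fun p => hGf x _)).trans_eq (by simp)
      have hms : MeasurableSet {p : ℝ × ℝ | M < ‖p‖} :=
        measurableSet_lt measurable_const measurable_norm
      have e1 : ∫ x, ∫ k, Γ x k ∂β ∂μ = α * ∫ x, ∫ p, G x (ι (cl p)) ∂P ∂μ := by
        simp_rw [hβ]
        exact integral_const_mul _ _
      have hci1 : Integrable (fun x => ∫ p, G x p ∂P) μ := hci id measurable_id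
      have hι' : Measurable fun p => ι (cl p) := (hι.comp hcl).measurable
      rw [e1, ← mul_sub, ← integral_sub (hci _ hι') hci1, abs_mul,
        abs_of_nonneg hα0]
      have hPr : P.real {p | M < ‖p‖} ≤ ε / (2 * ∫ x, f x ∂μ + 1) :=
        ENNReal.toReal_le_of_le_ofReal (by positivity) (hMP.trans (min_le_right _ _))
      have hx : ∀ x, |∫ p, G x (ι (cl p)) ∂P - ∫ p, G x p ∂P| ≤
          P.real {p | M < ‖p‖} * (2 * f x) := by
        intro x
        have hb1 : Integrable (fun p => G x (ι (cl p))) P := hbi x _ (hι.comp hcl)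
        have hb2 : Integrable (fun p => G x p) P := hbi x _ continuous_id
        rw [← integral_sub hb1 hb2, ← smul_eq_mul,
          ← integral_indicator_const _ hms]
        refine abs_integral_le_integral_abs.trans (integral_mono (hb1.sub hb2).abs
          ((integrable_const _).indicator hms) fun p => ?_)
        by_cases hp : M < ‖p‖
        · rw [indicator_of_mem (show p ∈ {p : ℝ × ℝ | M < ‖p‖} from hp)]
          linarith [abs_sub (G x (ι (cl p))) (G x p), hGf x p, hGf x (ι (cl p))]
        · rw [indicator_of_notMem (show p ∉ {p : ℝ × ℝ | M < ‖p‖} from hp), hιcl p hp]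
          simp
      have hint : |∫ x, (∫ p, G x (ι (cl p)) ∂P - ∫ p, G x p ∂P) ∂μ| ≤
          P.real {p | M < ‖p‖} * (2 * ∫ x, f x ∂μ) := by
        refine abs_integral_le_integral_abs.trans ((integral_mono
          ((hci _ hι').sub hci1).abs ((hfi.const_mul 2).const_mul _) hx).trans_eq ?_)
        rw [integral_const_mul, integral_const_mul]
      calc α * |∫ x, (∫ p, G x (ι (cl p)) ∂P - ∫ p, G x p ∂P) ∂μ|
          ≤ 1 * (ε / (2 * ∫ x, f x ∂μ + 1) * (2 * ∫ x, f x ∂μ)) := by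
            refine mul_le_mul hα1 (hint.trans ?_) (abs_nonneg _) zero_le_one
            gcongr
        _ ≤ ε := by
            rw [one_mul, div_mul_eq_mul_div, div_le_iff₀ (by positivity)]
            nlinarith
  · refine tendsto_setIntegral_inter_of_almost_invariant hT hV hVT
      (fun n => hcl.measurable.comp (hZ n)) (fun δ hδ => ?_) c ?_ hE
    · refine tendsto_of_tendsto_of_tendsto_of_le_of_le tendsto_const_nhds (hZT δ hδ)
        (fun n => zero_le) fun n => measure_mono ?_
      exact fun x hx => ⟨hx.1, hx.2.trans (hdist _ _)⟩
    · rw [hβ]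
      exact hlim ((BoundedContinuousFunction.mkOfCompact c).compContinuous ⟨cl, hcl⟩)

end JointLimit

/-! ### Overlaps in the fibres -/

section Overlap

variable {X : Type*}

/-- The points `r` of the fibre `[0, f x)` such that the sections of `U₁` over `x₁`, translated by
`t`, of `U₂` over `x₂`, translated by `u`, and of `U₃` over `x` contain `r`. -/
def fibreOverlap (f : X → ℝ) (U₁ U₂ U₃ : Set (X × ℝ)) (x₁ x₂ x : X) (t u : ℝ) : Set ℝ :=
  {r ∈ Ico 0 (f x) | (x₁, r - t) ∈ U₁ ∧ (x₂, r - u) ∈ U₂ ∧ (x, r) ∈ U₃}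

variable {f : X → ℝ} {U₁ U₂ U₃ : Set (X × ℝ)}

theorem volume_fibreOverlap_le (x₁ x₂ x : X) (t u : ℝ) :
    volume (fibreOverlap f U₁ U₂ U₃ x₁ x₂ x t u) ≤ ENNReal.ofReal (f x) :=
  (measure_mono (sep_subset _ _)).trans (by rw [Real.volume_Ico, sub_zero])

theorem volume_fibreOverlap_ne_top (x₁ x₂ x : X) (t u : ℝ) :
    volume (fibreOverlap f U₁ U₂ U₃ x₁ x₂ x t u) ≠ ⊤ :=
  ((volume_fibreOverlap_le x₁ x₂ x t u).trans_lt ENNReal.ofReal_lt_top).ne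

theorem measureReal_fibreOverlap_le (hf0 : ∀ x, 0 ≤ f x) (x₁ x₂ x : X) (t u : ℝ) :
    volume.real (fibreOverlap f U₁ U₂ U₃ x₁ x₂ x t u) ≤ f x :=
  ENNReal.toReal_le_of_le_ofReal (hf0 x) (volume_fibreOverlap_le x₁ x₂ x t u)

variable [MeasurableSpace X] {μ : Measure X}

theorem measurable_volume_fibreOverlap (hf : Measurable f) (h₁ : MeasurableSet U₁)
    (h₂ : MeasurableSet U₂) (h₃ : MeasurableSet U₃) {Ω : Type*} [MeasurableSpace Ω]
    {g₁ g₂ g : Ω → X} {t u : Ω → ℝ} (hg₁ : Measurable g₁) (hg₂ : Measurable g₂) (hg : Measurable g)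
    (ht : Measurable t) (hu : Measurable u) :
    Measurable fun ω => volume (fibreOverlap f U₁ U₂ U₃ (g₁ ω) (g₂ ω) (g ω) (t ω) (u ω)) := by
  have hS : MeasurableSet {q : Ω × ℝ |
      q.2 ∈ fibreOverlap f U₁ U₂ U₃ (g₁ q.1) (g₂ q.1) (g q.1) (t q.1) (u q.1)} := by
    refine MeasurableSet.inter (MeasurableSet.inter ?_ ?_) (MeasurableSet.inter ?_
      (MeasurableSet.inter ?_ ?_))
    · exact measurableSet_le measurable_const measurable_snd
    · exact measurableSet_lt measurable_snd (hf.comp (hg.comp measurable_fst))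
    · exact ((hg₁.comp measurable_fst).prodMk
        (measurable_snd.sub (ht.comp measurable_fst))) h₁
    · exact ((hg₂.comp measurable_fst).prodMk
        (measurable_snd.sub (hu.comp measurable_fst))) h₂
    · exact ((hg.comp measurable_fst).prodMk measurable_snd) h₃
  exact measurable_measure_prodMk_left hS

theorem continuous_fibreOverlap (h₁ : MeasurableSet U₁) (h₂ : MeasurableSet U₂)
    (h₃ : MeasurableSet U₃) (x : X) :
    Continuous fun p : ℝ × ℝ => volume.real (fibreOverlap f U₁ U₂ U₃ x x x p.1 p.2) := by
  have hQ : MeasurableSet (Ico 0 (f x) ∩ {r | (x, r) ∈ U₃}) :=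
    measurableSet_Ico.inter (measurable_prodMk_left h₃)
  have := continuous_volume_translate_inter (measurable_prodMk_left (x := x) h₁)
    (measurable_prodMk_left (x := x) h₂) hQ
    (inter_subset_left.trans Ico_subset_Icc_self)
  convert! this using 3 with p
  ext r
  simp only [fibreOverlap, mem_ofPred_eq, mem_inter_iff, mem_preimage]
  tauto

/-- The two overlaps differ only at heights where membership in `U₁` or in `U₂` changes with the
base point, which is the quantity that `tendsto_setLIntegral_fibre_of_rigid` sends to `0`. -/
theorem abs_measureReal_fibreOverlap_sub_le (h₁ : MeasurableSet U₁)
    (h₂ : MeasurableSet U₂) (h₃ : MeasurableSet U₃) (x₁ x₂ x : X) (t u : ℝ) :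
    |volume.real (fibreOverlap f U₁ U₂ U₃ x₁ x₂ x t u) -
      volume.real (fibreOverlap f U₁ U₂ U₃ x x x t u)| ≤
    volume.real {r ∈ Ico 0 (f x) | ¬((x₁, r - t) ∈ U₁ ↔ (x, r - t) ∈ U₁)} +
      volume.real {r ∈ Ico 0 (f x) | ¬((x₂, r - u) ∈ U₂ ↔ (x, r - u) ∈ U₂)} := by
  have hm : ∀ y₁ y₂, MeasurableSet (fibreOverlap f U₁ U₂ U₃ y₁ y₂ x t u) := fun y₁ y₂ =>
    measurableSet_Ico.inter
      (((measurable_const.prodMk (measurable_id.sub_const t)) h₁).inter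
        (((measurable_const.prodMk (measurable_id.sub_const u)) h₂).inter
          (measurable_prodMk_left h₃)))
  have hfin : ∀ R ⊆ Ico 0 (f x), volume R ≠ ⊤ := fun R hR =>
    measure_ne_top_of_subset hR (by simp)
  refine (abs_measureReal_sub_le_measureReal_symmDiff' (hm _ _).nullMeasurableSet
    (hm _ _).nullMeasurableSet (hfin _ (sep_subset _ _)) (hfin _ (sep_subset _ _))).trans ?_
  refine le_trans ?_ (measureReal_union_le _ _)
  refine measureReal_mono ?_ (hfin _ (union_subset (sep_subset _ _) (sep_subset _ _)))
  intro r hr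
  simp only [mem_symmDiff, fibreOverlap, mem_ofPred_eq, mem_union] at hr ⊢
  tauto

/-- The integrals over `Vₙ` of the fibre overlaps at the points `τ'ₙ x`, `τₙ x`, `x`, translated by
`Zₙ x`, converge to the average over `P` of the overlaps over a single point. -/
theorem tendsto_setLIntegral_fibreOverlap [IsProbabilityMeasure μ] {V : ℕ → Set X}
    {Z : ℕ → X → ℝ × ℝ} {α : ℝ} {P : Measure (ℝ × ℝ)} [IsProbabilityMeasure P]
    {T : X → X} (hT : Ergodic T μ) (hV : ∀ n, MeasurableSet (V n))
    (hVT : Tendsto (fun n => μ (symmDiff (V n) (T ⁻¹' V n))) atTop (𝓝 0))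
    (hZ : ∀ n, Measurable (Z n))
    (hZT : ∀ δ > 0, Tendsto (fun n => μ {x ∈ V n | δ ≤ dist (Z n (T x)) (Z n x)}) atTop (𝓝 0))
    (hα0 : 0 ≤ α) (hα1 : α ≤ 1)
    (hlim : ∀ φ : ℝ × ℝ →ᵇ ℝ, Tendsto (fun n => ∫ x in V n, φ (Z n x) ∂μ) atTop
      (𝓝 (α * ∫ p, φ p ∂P)))
    {τ τ' : ℕ → X → X} (hτ : ∀ n, Measurable (τ n)) (hτ' : ∀ n, Measurable (τ' n))
    (hVτ : ∀ A : Set X, MeasurableSet A →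
      Tendsto (fun n => μ (symmDiff (τ n ⁻¹' A) A ∩ V n)) atTop (𝓝 0))
    (hVτ' : ∀ A : Set X, MeasurableSet A →
      Tendsto (fun n => μ (symmDiff (τ' n ⁻¹' A) A ∩ V n)) atTop (𝓝 0))
    (hf : Measurable f) (hfi : Integrable f μ) (hf0 : ∀ x, 0 ≤ f x)
    (h₁ : MeasurableSet U₁) (h₂ : MeasurableSet U₂) (h₃ : MeasurableSet U₃) :
    Tendsto (fun n => ∫⁻ x in V n,
        volume (fibreOverlap f U₁ U₂ U₃ (τ' n x) (τ n x) x (Z n x).1 (Z n x).2) ∂μ) atTop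
      (𝓝 (ENNReal.ofReal α *
        ∫⁻ p, ∫⁻ x, volume (fibreOverlap f U₁ U₂ U₃ x x x p.1 p.2) ∂μ ∂P)) := by
  have htight : ∀ ε : ENNReal, 0 < ε →
      ∃ M : ℝ, ∀ᶠ n in atTop, μ {x ∈ V n | M < ‖Z n x‖} ≤ ε := fun ε hε => by
    obtain ⟨M, -, hM, -⟩ := exists_tight_of_tendsto hV hZ hα0 hα1 hlim hε
    exact ⟨M, hM⟩
  have hZ1 : ∀ n, Measurable fun x => (Z n x).1 := fun n => (hZ n).fst
  have hZ2 : ∀ n, Measurable fun x => (Z n x).2 := fun n => (hZ n).snd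
  have r1 := tendsto_setLIntegral_fibre_of_rigid hτ' hV hVτ' hf hfi hZ1 (fun ε hε => by
    obtain ⟨M, hM⟩ := htight ε hε
    refine ⟨M, hM.mono fun n hn => (measure_mono ?_).trans hn⟩
    exact fun x hx => ⟨hx.1, hx.2.trans_le (norm_fst_le (Z n x))⟩) h₁
  have r2 := tendsto_setLIntegral_fibre_of_rigid hτ hV hVτ hf hfi hZ2 (fun ε hε => by
    obtain ⟨M, hM⟩ := htight ε hε
    refine ⟨M, hM.mono fun n hn => (measure_mono ?_).trans hn⟩
    exact fun x hx => ⟨hx.1, hx.2.trans_le (norm_snd_le (Z n x))⟩) h₂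
  let G : X → ℝ × ℝ → ℝ := fun x p => volume.real (fibreOverlap f U₁ U₂ U₃ x x x p.1 p.2)
  have hGm : Measurable (Function.uncurry G) :=
    (measurable_volume_fibreOverlap hf h₁ h₂ h₃ (Ω := X × (ℝ × ℝ)) measurable_fst measurable_fst
      measurable_fst measurable_snd.fst measurable_snd.snd).ennreal_toReal
  have hGf : ∀ x p, |G x p| ≤ f x := fun x p => by
    rw [abs_of_nonneg measureReal_nonneg]
    exact measureReal_fibreOverlap_le hf0 _ _ _ _ _
  have k1 := tendsto_setIntegral_of_caratheodory hT hV hVT hZ hZT hα0 hα1 hlim hfi hGm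
    (continuous_fibreOverlap h₁ h₂ h₃) hGf
  let H : ℕ → X → ℝ := fun n x =>
    volume.real (fibreOverlap f U₁ U₂ U₃ (τ' n x) (τ n x) x (Z n x).1 (Z n x).2)
  have hHm : ∀ n, Measurable (H n) := fun n => (measurable_volume_fibreOverlap hf h₁ h₂ h₃
    (hτ' n) (hτ n) measurable_id (hZ1 n) (hZ2 n)).ennreal_toReal
  have hHi : ∀ n, Integrable (H n) μ := fun n => hfi.mono' (hHm n).aestronglyMeasurable
    (ae_of_all _ fun x => by
      rw [Real.norm_eq_abs, abs_of_nonneg measureReal_nonneg]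
      exact measureReal_fibreOverlap_le hf0 _ _ _ _ _)
  have hGi : ∀ n, Integrable (fun x => G x (Z n x)) μ := fun n =>
    hfi.mono' (hGm.comp (measurable_id.prodMk (hZ n))).aestronglyMeasurable
      (ae_of_all _ fun x => hGf x _)
  -- By rigidity the base points `τ' n x` and `τ n x` may be replaced by `x`, which turns `H n x`
  -- into `G x (Z n x)`.
  have k2 : Tendsto (fun n => ∫ x in V n, H n x ∂μ) atTop (𝓝 (α * ∫ x, ∫ p, G x p ∂P ∂μ)) := by
    have hd : Tendsto (fun n => ∫ x in V n, H n x ∂μ - ∫ x in V n, G x (Z n x) ∂μ) atTop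
        (𝓝 0) := by
      have hDm : ∀ n, Measurable fun x => volume {r ∈ Ico 0 (f x) |
          ¬((τ' n x, r - (Z n x).1) ∈ U₁ ↔ (x, r - (Z n x).1) ∈ U₁)} := by
        intro n
        have hs : Measurable fun q : X × ℝ => q.2 - (Z n q.1).1 :=
          measurable_snd.sub ((hZ1 n).comp measurable_fst)
        have hS : MeasurableSet {q : X × ℝ | q.2 ∈ Ico 0 (f q.1) ∧
            ¬((τ' n q.1, q.2 - (Z n q.1).1) ∈ U₁ ↔ (q.1, q.2 - (Z n q.1).1) ∈ U₁)} := by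
          refine MeasurableSet.inter ((measurableSet_le measurable_const measurable_snd).inter
            (measurableSet_lt measurable_snd (hf.comp measurable_fst))) ?_
          exact (MeasurableSet.iff ((((hτ' n).comp measurable_fst).prodMk hs) h₁)
            ((measurable_fst.prodMk hs) h₁)).compl
        exact measurable_measure_prodMk_left hS
      have hle : ∀ n, ‖∫ x in V n, H n x ∂μ - ∫ x in V n, G x (Z n x) ∂μ‖ₑ ≤
          ∫⁻ x in V n, volume {r ∈ Ico 0 (f x) |
            ¬((τ' n x, r - (Z n x).1) ∈ U₁ ↔ (x, r - (Z n x).1) ∈ U₁)} ∂μ +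
          ∫⁻ x in V n, volume {r ∈ Ico 0 (f x) |
            ¬((τ n x, r - (Z n x).2) ∈ U₂ ↔ (x, r - (Z n x).2) ∈ U₂)} ∂μ := by
        intro n
        rw [← integral_sub (hHi n).integrableOn (hGi n).integrableOn,
          ← lintegral_add_left (hDm n)]
        refine (enorm_integral_le_lintegral_enorm _).trans (lintegral_mono fun x => ?_)
        have hfin : ∀ R ⊆ Ico 0 (f x), volume R ≠ ⊤ := fun R hR =>
          measure_ne_top_of_subset hR (by simp)
        rw [Real.enorm_eq_ofReal_abs]
        refine (ENNReal.ofReal_le_ofReal (abs_measureReal_fibreOverlap_sub_le h₁ h₂ h₃ _ _ x _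
          _)).trans ?_
        rw [ENNReal.ofReal_add measureReal_nonneg measureReal_nonneg,
          ofReal_measureReal (hfin _ (sep_subset _ _)), ofReal_measureReal (hfin _ (sep_subset _ _))]
      have hz : Tendsto (fun n => ‖∫ x in V n, H n x ∂μ - ∫ x in V n, G x (Z n x) ∂μ‖ₑ) atTop
          (𝓝 0) :=
        tendsto_of_tendsto_of_tendsto_of_le_of_le tendsto_const_nhds
          (by simpa using r1.add r2) (fun n => zero_le) hle
      rw [tendsto_zero_iff_norm_tendsto_zero]
      refine ((ENNReal.tendsto_toReal ENNReal.zero_ne_top).comp hz).congr fun n => ?_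
      exact toReal_enorm _
    simpa using hd.add k1
  have hP : ∫⁻ p, ∫⁻ x, volume (fibreOverlap f U₁ U₂ U₃ x x x p.1 p.2) ∂μ ∂P =
      ENNReal.ofReal (∫ x, ∫ p, G x p ∂P ∂μ) := by
    have hmeas : Measurable fun q : (ℝ × ℝ) × X =>
        volume (fibreOverlap f U₁ U₂ U₃ q.2 q.2 q.2 q.1.1 q.1.2) :=
      measurable_volume_fibreOverlap hf h₁ h₂ h₃ measurable_snd measurable_snd measurable_snd
        measurable_fst.fst measurable_fst.snd
    have hgi : ∀ x, Integrable (G x) P := fun x =>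
      Integrable.of_bound (continuous_fibreOverlap h₁ h₂ h₃ x).aestronglyMeasurable (f x)
        (ae_of_all _ fun p => hGf x p)
    have hgi' : Integrable (fun x => ∫ p, G x p ∂P) μ := by
      refine hfi.mono' ?_ (ae_of_all _ fun x => ?_)
      · exact (StronglyMeasurable.integral_prod_right hGm.stronglyMeasurable).aestronglyMeasurable
      · exact (norm_integral_le_of_norm_le_const (C := f x)
          (ae_of_all _ fun p => hGf x p)).trans_eq (by simp)
    rw [lintegral_lintegral_swap hmeas.aemeasurable, ofReal_integral_eq_lintegral_ofReal hgi'
      (ae_of_all _ fun x => integral_nonneg fun p => measureReal_nonneg)]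
    refine lintegral_congr fun x => ?_
    rw [ofReal_integral_eq_lintegral_ofReal (hgi x) (ae_of_all _ fun p => measureReal_nonneg)]
    exact lintegral_congr fun p =>
      (ENNReal.ofReal_toReal (volume_fibreOverlap_ne_top _ _ _ _ _)).symm
  rw [hP, ← ENNReal.ofReal_mul hα0]
  refine (ENNReal.tendsto_ofReal k2).congr fun n => ?_
  rw [ofReal_integral_eq_lintegral_ofReal (hHi n).integrableOn
    (ae_of_all _ fun x => measureReal_nonneg)]
  exact lintegral_congr fun x => ENNReal.ofReal_toReal (volume_fibreOverlap_ne_top _ _ _ _ _)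

end Overlap

/-! ### Off-diagonal joinings with a partial limit -/

section PartialLimit

variable {Y : Type*} [MeasurableSpace Y] {Φ : ℝ → Y → Y} {m : Measure Y}
  {t u : ℕ → ℝ} {V : ℕ → Set Y} {J : Measure (Y × Y × Y)} {α : ℝ}

theorem offDiagonal3_restrict_add (hΦ : ∀ t, Measurable (Φ t)) {E : Set Y} (hE : MeasurableSet E)
    (t u : ℝ) : offDiagonal3 Φ m t u =
      offDiagonal3 Φ (m.restrict E) t u + offDiagonal3 Φ (m.restrict Eᶜ) t u := by
  have hF : Measurable fun y => (Φ t y, Φ u y, y) := by fun_prop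
  rw [offDiagonal3, offDiagonal3, offDiagonal3, ← Measure.map_add _ _ hF,
    Measure.restrict_add_restrict_compl hE]

theorem offDiagonal3_univ (hΦ : ∀ t, Measurable (Φ t)) (m : Measure Y) (t u : ℝ) :
    offDiagonal3 Φ m t u univ = m univ := by
  have hF : Measurable fun y => (Φ t y, Φ u y, y) := by fun_prop
  rw [offDiagonal3, Measure.map_apply hF .univ, preimage_univ]

theorem TendstoJoining3.unique {l : ℕ → Measure (Y × Y × Y)} {ρ ρ' : Measure (Y × Y × Y)}
    (h : TendstoJoining3 Φ m l ρ) (h' : TendstoJoining3 Φ m l ρ') : ρ = ρ' := by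
  have := h.joining_limit.prob
  exact Measure.ext_prod₃ fun {A B C} hA hB hC =>
    tendsto_nhds_unique (h.tendsto A B C hA hB hC) (h'.tendsto A B C hA hB hC)

theorem TendstoJoining3.comp_strictMono {l : ℕ → Measure (Y × Y × Y)} {ρ : Measure (Y × Y × Y)}
    (h : TendstoJoining3 Φ m l ρ) {j : ℕ → ℕ} (hj : StrictMono j) :
    TendstoJoining3 Φ m (fun n => l (j n)) ρ :=
  ⟨fun n => h.joining (j n), h.joining_limit, fun A B C hA hB hC =>
    (h.tendsto A B C hA hB hC).comp hj.tendsto_atTop⟩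

variable [IsProbabilityMeasure m]

/-- The box `Y × Y × Y` in the hypothesis reads off the mass of `V n`. -/
theorem tendsto_measure_compl_of_partial (hΦ : ∀ t, Measurable (Φ t)) (hJ : IsJoining3 Φ m J)
    (hV : ∀ n, MeasurableSet (V n)) (hα0 : 0 ≤ α)
    (hσ : ∀ A B C : Set Y, MeasurableSet A → MeasurableSet B → MeasurableSet C →
      Tendsto (fun n => offDiagonal3 Φ (m.restrict (V n)) (t n) (u n) (A ×ˢ B ×ˢ C)) atTop
        (𝓝 (ENNReal.ofReal α * J (A ×ˢ B ×ˢ C)))) :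
    Tendsto (fun n => m (V n)ᶜ) atTop (𝓝 (ENNReal.ofReal (1 - α))) := by
  have h := hσ univ univ univ .univ .univ .univ
  have := hJ.prob
  simp only [univ_prod_univ, offDiagonal3_univ hΦ, measure_univ, mul_one, Measure.restrict_apply_univ]
    at h
  simp_rw [fun n => prob_compl_eq_one_sub (μ := m) (hV n)]
  rw [ENNReal.ofReal_sub _ hα0, ENNReal.ofReal_one]
  exact ENNReal.Tendsto.sub tendsto_const_nhds h (Or.inl ENNReal.one_ne_top)

theorem tendstoJoining3_of_partial_one (hΦ : ∀ t, MeasurePreserving (Φ t) m m)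
    (hcomm : ∀ s t y, Φ s (Φ t y) = Φ t (Φ s y)) (hJ : IsJoining3 Φ m J)
    (hV : ∀ n, MeasurableSet (V n))
    (hσ : ∀ A B C : Set Y, MeasurableSet A → MeasurableSet B → MeasurableSet C →
      Tendsto (fun n => offDiagonal3 Φ (m.restrict (V n)) (t n) (u n) (A ×ˢ B ×ˢ C)) atTop
        (𝓝 (ENNReal.ofReal 1 * J (A ×ˢ B ×ˢ C)))) :
    TendstoJoining3 Φ m (fun n => offDiagonal3 Φ m (t n) (u n)) J := by
  have hm : ∀ t, Measurable (Φ t) := fun t => (hΦ t).measurable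
  refine ⟨fun n => isJoining3_offDiagonal3 hΦ hcomm _ _, hJ, fun A B C hA hB hC => ?_⟩
  have hθ := tendsto_measure_compl_of_partial hm hJ hV zero_le_one hσ
  rw [sub_self, ENNReal.ofReal_zero] at hθ
  have hτ : Tendsto (fun n => offDiagonal3 Φ (m.restrict (V n)ᶜ) (t n) (u n) (A ×ˢ B ×ˢ C)) atTop
      (𝓝 0) := by
    refine tendsto_of_tendsto_of_tendsto_of_le_of_le tendsto_const_nhds hθ (fun n => zero_le)
      fun n => (measure_mono (subset_univ _)).trans_eq ?_
    rw [offDiagonal3_univ hm, Measure.restrict_apply_univ]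
  have := (hσ A B C hA hB hC).add hτ
  rw [ENNReal.ofReal_one, one_mul, add_zero] at this
  refine this.congr fun n => ?_
  rw [offDiagonal3_restrict_add (m := m) hm (hV n), Measure.add_apply]

/-- The part over the complement of `V n`, normalized, has marginals at most a constant times `m`,
hence a limit `ν` along a subsequence. The whole limit and `J` are joinings, so `ν` is one as well.
-/
theorem exists_subseq_tendstoJoining3_of_partial [StandardBorelSpace Y]
    (hΦ : ∀ t, MeasurePreserving (Φ t) m m)
    (hcomm : ∀ s t y, Φ s (Φ t y) = Φ t (Φ s y)) (hJ : IsJoining3 Φ m J)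
    (hV : ∀ n, MeasurableSet (V n)) (hα0 : 0 ≤ α) (hα1 : α ≤ 1)
    (hσ : ∀ A B C : Set Y, MeasurableSet A → MeasurableSet B → MeasurableSet C →
      Tendsto (fun n => offDiagonal3 Φ (m.restrict (V n)) (t n) (u n) (A ×ˢ B ×ˢ C)) atTop
        (𝓝 (ENNReal.ofReal α * J (A ×ˢ B ×ˢ C)))) :
    ∃ j : ℕ → ℕ, StrictMono j ∧ ∃ ν, IsJoining3 Φ m ν ∧
      TendstoJoining3 Φ m (fun n => offDiagonal3 Φ m (t (j n)) (u (j n)))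
        (ENNReal.ofReal α • J + ENNReal.ofReal (1 - α) • ν) := by
  have hm : ∀ t, Measurable (Φ t) := fun t => (hΦ t).measurable
  rcases hα1.eq_or_lt with rfl | hα
  -- For `α = 1` the joining `ν` has weight `0`, and `J` is an arbitrary choice.
  · refine ⟨id, strictMono_id, J, hJ, ?_⟩
    have := tendstoJoining3_of_partial_one hΦ hcomm hJ hV hσ
    simpa using this
  have hθ := tendsto_measure_compl_of_partial hm hJ hV hα0 hσ
  have hβ : 0 < ENNReal.ofReal (1 - α) := ENNReal.ofReal_pos.2 (by linarith)
  -- From `N` on, the complements have mass above `b`, so normalizing costs at most the factor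
  -- `b⁻¹`.
  obtain ⟨b, hb0, hb⟩ := exists_between hβ
  obtain ⟨N, hN⟩ := (hθ.eventually (lt_mem_nhds hb)).exists_forall_of_atTop
  set τ : ℕ → Measure (Y × Y × Y) := fun n =>
    offDiagonal3 Φ (m.restrict (V (n + N))ᶜ) (t (n + N)) (u (n + N)) with hτ
  set θ : ℕ → ENNReal := fun n => m (V (n + N))ᶜ
  have hθ0 : ∀ n, θ n ≠ 0 := fun n => (hb0.trans (hN _ (Nat.le_add_left _ _))).ne'
  have hθt : ∀ n, θ n ≠ ⊤ := fun n => measure_ne_top _ _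
  have hθb : ∀ n, (θ n)⁻¹ ≤ b⁻¹ := fun n =>
    ENNReal.inv_le_inv.2 (hN _ (Nat.le_add_left _ _)).le
  have hprob : ∀ n, IsProbabilityMeasure ((θ n)⁻¹ • τ n) := by
    refine fun n => ⟨?_⟩
    rw [Measure.smul_apply, hτ, offDiagonal3_univ hm, Measure.restrict_apply_univ, smul_eq_mul]
    exact ENNReal.inv_mul_cancel (hθ0 n) (hθt n)
  have hfin : IsFiniteMeasure (b⁻¹ • m) := by
    refine ⟨?_⟩
    simp [ENNReal.inv_lt_top, hb0]
  have hmarg : ∀ (g : Y × Y × Y → Y), Measurable g →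
      (∀ n, m.map (fun y => g (Φ (t n) y, Φ (u n) y, y)) = m) →
      ∀ n, ((θ n)⁻¹ • τ n).map g ≤ b⁻¹ • m := by
    intro g hg hgm n
    rw [Measure.map_smul, hτ, map_offDiagonal3 hm _ _ _ hg]
    have h1 : (m.restrict (V (n + N))ᶜ).map
        (fun y => g (Φ (t (n + N)) y, Φ (u (n + N)) y, y)) ≤ m :=
      (Measure.map_mono Measure.restrict_le_self (by fun_prop)).trans_eq (hgm _)
    refine Measure.le_iff'.2 fun S => ?_
    simp only [Measure.smul_apply, smul_eq_mul]
    exact mul_le_mul' (hθb n) (h1 S)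
  obtain ⟨j, hj, ν, hν, hlim⟩ := exists_subseq_tendsto_box (b⁻¹ • m) (fun n => (θ n)⁻¹ • τ n)
    (hmarg _ (by fun_prop) fun n => (hΦ (t n)).map_eq)
    (hmarg _ (by fun_prop) fun n => (hΦ (u n)).map_eq)
    (hmarg _ (by fun_prop) fun n => Measure.map_id)
  have hj' : StrictMono fun n => j n + N := fun a b hab => Nat.add_lt_add_right (hj hab) N
  have hbox : ∀ A B C : Set Y, MeasurableSet A → MeasurableSet B → MeasurableSet C →
      Tendsto (fun n => offDiagonal3 Φ m (t (j n + N)) (u (j n + N)) (A ×ˢ B ×ˢ C)) atTop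
        (𝓝 ((ENNReal.ofReal α • J + ENNReal.ofReal (1 - α) • ν) (A ×ˢ B ×ˢ C))) := by
    intro A B C hA hB hC
    have l1 := (hσ A B C hA hB hC).comp hj'.tendsto_atTop
    have l2 : Tendsto (fun n => θ (j n) * ((θ (j n))⁻¹ • τ (j n)) (A ×ˢ B ×ˢ C)) atTop
        (𝓝 (ENNReal.ofReal (1 - α) * ν (A ×ˢ B ×ˢ C))) :=
      ENNReal.Tendsto.mul (hθ.comp hj'.tendsto_atTop) (Or.inl hβ.ne') (hlim A B C hA hB hC)
        (Or.inr ENNReal.ofReal_ne_top)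
    rw [Measure.add_apply, Measure.smul_apply, Measure.smul_apply, smul_eq_mul, smul_eq_mul]
    refine (l1.add l2).congr fun n => ?_
    rw [offDiagonal3_restrict_add (m := m) hm (hV (j n + N)), Measure.add_apply, Measure.smul_apply,
      smul_eq_mul, ← mul_assoc, ENNReal.mul_inv_cancel (hθ0 _) (hθt _), one_mul]
    rfl
  have hjoin := fun n => isJoining3_offDiagonal3 hΦ hcomm (t (j n + N)) (u (j n + N))
  have hL := IsJoining3.of_tendsto hm hjoin hbox
  refine ⟨fun n => j n + N, hj', ν, ?_, hjoin, hL, hbox⟩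
  refine IsJoining3.of_convex_combination hm ?_ hβ.ne' hJ hL
  rw [← ENNReal.ofReal_add hα0 (by linarith), add_sub_cancel, ENNReal.ofReal_one]

end PartialLimit

/-! ### The special flow -/

section SpecialFlow

variable {X : Type*} [MeasurableSpace X] (T : X ≃ᵐ X) (f : X → ℝ) (hf : ∃ c > 0, ∀ x, c ≤ f x)

/-- Fubini over the base, after lifting to `X × ℝ`, where the flow by `t` is `r ↦ r + t`; hence the
signs `-t` and `-u`. -/
theorem offDiagonal3_specialFlow_apply (hfm : Measurable f) (μ : Measure X) {V : Set X}
    (hV : MeasurableSet V) (t u : ℝ) {A B C : Set (specialSpace f)} (hA : MeasurableSet A)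
    (hB : MeasurableSet B) (hC : MeasurableSet C) :
    offDiagonal3 (specialFlow T f hf) ((specialProb μ f).restrict {y | y.1.1 ∈ V}) t u
        (A ×ˢ B ×ˢ C) =
      (specialMeasure μ f univ)⁻¹ * ∫⁻ x in V, volume (fibreOverlap f (specialProj T f hf ⁻¹' A)
        (specialProj T f hf ⁻¹' B) (specialProj T f hf ⁻¹' C) x x x (-t) (-u)) ∂μ := by
  have hm := measurable_specialFlow T f hf hfm
  have hπ := measurable_specialProj T f hf hfm
  have hbase : Measurable fun y : specialSpace f => y.1.1 :=
    measurable_fst.comp measurable_subtype_coe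
  have hS : MeasurableSet (specialFlow T f hf t ⁻¹' A ∩ (specialFlow T f hf u ⁻¹' B ∩ C)) :=
    (hm t hA).inter ((hm u hB).inter hC)
  have hSV := hS.inter (hbase hV)
  rw [offDiagonal3_apply hm _ _ _ hA hB hC, Measure.restrict_apply hS, specialProb,
    Measure.smul_apply, smul_eq_mul]
  congr 1
  have e := specialMeasure_apply T f hf hfm μ hSV
  refine e.trans ?_
  rw [Measure.prod_apply ((measurableSet_specialSpace f hfm).inter (hπ hSV)),
    ← lintegral_indicator hV]
  refine lintegral_congr fun x => ?_
  by_cases hx : x ∈ V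
  · rw [indicator_of_mem hx]
    congr 1
    ext r
    simp only [fibreOverlap, mem_preimage, mem_inter_iff, specialFlow_specialProj, sub_neg_eq_add,
      mem_ofPred_eq]
    constructor
    · rintro ⟨h1, ⟨h2, h3, h4⟩, -⟩
      exact ⟨h1, h2, h3, h4⟩
    · rintro ⟨h1, h2, h3, h4⟩
      refine ⟨h1, ⟨h2, h3, h4⟩, ?_⟩
      rw [specialProj_coe T f hf ⟨(x, r), h1⟩]
      exact hx
  · rw [indicator_of_notMem hx]
    refine measure_mono_null (t := ∅) ?_ measure_empty
    rintro r ⟨h1, -, h2⟩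
    rw [mem_preimage, specialProj_coe T f hf ⟨(x, r), h1⟩] at h2
    exact hx h2

/-- The points `(x, r + a)` and `(T^q x, r + a - f⁽q⁾(x))` lie on one `skewShift`-orbit, and `a -
f⁽q⁾` is minus the centred sum. The large time `a` is thus traded for a tight translation and a
nearly trivial move of the base point. -/
theorem fibreOverlap_specialProj_eq (A B C : Set (specialSpace f)) (q q' : ℕ) (a a' : ℝ) (x : X) :
    fibreOverlap f (specialProj T f hf ⁻¹' A) (specialProj T f hf ⁻¹' B)
        (specialProj T f hf ⁻¹' C) x x x (-a') (-a) =
      fibreOverlap f (specialProj T f hf ⁻¹' A) (specialProj T f hf ⁻¹' B)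
        (specialProj T f hf ⁻¹' C) (T^[q'] x) (T^[q] x) x (centred T f q' a' x)
        (centred T f q a x) := by
  have h : ∀ (q : ℕ) (a r : ℝ), specialProj T f hf (T^[q] x, r - centred T f q a x) =
      specialProj T f hf (x, r - -a) := by
    intro q a r
    rw [← specialProj_skewShift T f hf q (x, r - -a), skewShift, iter_natCast, centred]
    congr 2
    ring
  simp only [fibreOverlap, mem_preimage, h]

theorem measurable_centred (hfm : Measurable f) (q : ℕ) (a : ℝ) : Measurable (centred T f q a) :=
  (measurable_cocycle T f hfm q).sub_const a

theorem centred_apply_sub (q : ℕ) (a : ℝ) (x : X) :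
    centred T f q a (T x) - centred T f q a x = f (T^[q] x) - f x := by
  rw [centred, centred, sub_sub_sub_cancel_right, cocycle_apply_sub, iter_natCast]

/-- The part of the off-diagonal joinings over the sets `Wₙ` converges to a multiple of the integral
joining. -/
theorem tendsto_offDiagonal3_restrict {μ : Measure X} [IsProbabilityMeasure μ]
    (hT : Ergodic T μ) (hfm : Measurable f) (hfi : Integrable f μ)
    {W : ℕ → Set X} (hW : ∀ n, MeasurableSet (W n)) {q q' : ℕ → ℕ} {a a' : ℕ → ℝ} {α : ℝ}
    (hα0 : 0 ≤ α) (hα1 : α ≤ 1) {P : Measure (ℝ × ℝ)} [IsProbabilityMeasure P]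
    (hWT : Tendsto (fun n => μ (symmDiff (W n) (T ⁻¹' W n))) atTop (𝓝 0))
    (hq : IsRigiditySeqAlong μ T W q) (hq' : IsRigiditySeqAlong μ T W q')
    (hlim : ∀ φ : ℝ × ℝ →ᵇ ℝ, Tendsto
      (fun n => ∫ x in W n, φ (centred T f (q' n) (a' n) x, centred T f (q n) (a n) x) ∂μ) atTop
      (𝓝 (α * ∫ p, φ p ∂P)))
    {A B C : Set (specialSpace f)} (hA : MeasurableSet A) (hB : MeasurableSet B)
    (hC : MeasurableSet C) :
    Tendsto (fun n => offDiagonal3 (specialFlow T f hf)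
        ((specialProb μ f).restrict {y | y.1.1 ∈ W n}) (a' n) (a n) (A ×ˢ B ×ˢ C)) atTop
      (𝓝 (ENNReal.ofReal α *
        integralJoining3 (specialFlow T f hf) (specialProb μ f) P (A ×ˢ B ×ˢ C))) := by
  have hπ := measurable_specialProj T f hf hfm
  have hprob := isProbabilityMeasure_specialProb f hf hfm μ hfi
  have hf0 : ∀ x, 0 ≤ f x := fun x => by
    obtain ⟨c, hc, h⟩ := hf
    exact hc.le.trans (h x)
  have hc := measurable_centred T f hfm
  have hJ : integralJoining3 (specialFlow T f hf) (specialProb μ f) P (A ×ˢ B ×ˢ C) =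
      (specialMeasure μ f univ)⁻¹ * ∫⁻ p, ∫⁻ x, volume (fibreOverlap f
        (specialProj T f hf ⁻¹' A) (specialProj T f hf ⁻¹' B) (specialProj T f hf ⁻¹' C)
        x x x p.1 p.2) ∂μ ∂P := by
    rw [integralJoining3_apply (measurable_specialFlow_uncurry T f hf hfm) P
      (hA.prod (hB.prod hC)), ← lintegral_const_mul']
    · refine lintegral_congr fun p => ?_
      have := offDiagonal3_specialFlow_apply T f hf hfm μ .univ (-p.1) (-p.2) hA hB hC
      simpa using this
    · exact ENNReal.inv_ne_top.2 (specialMeasure_univ_ne_zero f hf hfm μ)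
  rw [hJ, mul_left_comm]
  simp_rw [fun n => offDiagonal3_specialFlow_apply T f hf hfm μ (hW n) (a' n) (a n) hA hB hC,
    fun n => fibreOverlap_specialProj_eq T f hf A B C (q n) (q' n) (a n) (a' n)]
  refine ENNReal.Tendsto.const_mul ?_
    (Or.inr (ENNReal.inv_ne_top.2 (specialMeasure_univ_ne_zero f hf hfm μ)))
  refine tendsto_setLIntegral_fibreOverlap hT hW hWT
    (Z := fun n x => (centred T f (q' n) (a' n) x, centred T f (q n) (a n) x))
    (fun n => (hc _ _).prodMk (hc _ _)) (fun δ hδ => ?_) hα0 hα1 hlim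
    (fun n => T.measurable.iterate (q n)) (fun n => T.measurable.iterate (q' n)) hq.2 hq'.2 hfm hfi
    hf0 (hπ hA) (hπ hB) (hπ hC)
  -- The increment of a centred sum along `T` is `f ∘ T^q - f`, small in measure by rigidity.
  have h1 := tendsto_measure_dist_ge_of_rigid hq'.2 hfm hδ
  have h2 := tendsto_measure_dist_ge_of_rigid hq.2 hfm hδ
  have h12 := h1.add h2
  rw [add_zero] at h12
  refine tendsto_of_tendsto_of_tendsto_of_le_of_le tendsto_const_nhds h12 (fun n => zero_le)
    fun n => (measure_mono ?_).trans (measure_union_le _ _)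
  rintro x ⟨hx, hd⟩
  rw [Prod.dist_eq, le_max_iff, Real.dist_eq, Real.dist_eq, centred_apply_sub,
    centred_apply_sub] at hd
  exact hd.imp (fun h => ⟨hx, h⟩) fun h => ⟨hx, h⟩

end SpecialFlow

/-! ### From conditional laws to the convergence of joinings -/

theorem tendsto_setIntegral_of_tendsto_cond {X E : Type*} [MeasurableSpace X] [MeasurableSpace E]
    [TopologicalSpace E] [OpensMeasurableSpace E] {μ : Measure X} [IsFiniteMeasure μ]
    {W : ℕ → Set X} {Z : ℕ → X → E} (hZ : ∀ n, Measurable (Z n)) {α l : ℝ}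
    (hW : Tendsto (fun n => μ.real (W n)) atTop (𝓝 α)) (φ : E →ᵇ ℝ)
    (h : Tendsto (fun n => ∫ z, φ z ∂((ProbabilityTheory.cond μ (W n)).map (Z n))) atTop (𝓝 l)) :
    Tendsto (fun n => ∫ x in W n, φ (Z n x) ∂μ) atTop (𝓝 (α * l)) := by
  refine (hW.mul h).congr fun n => ?_
  rw [integral_map (hZ n).aemeasurable φ.continuous.measurable.aestronglyMeasurable,
    ProbabilityTheory.cond, integral_smul_measure, smul_eq_mul, ENNReal.toReal_inv, ← mul_assoc]
  -- On a null set the conditional measure is `0`, and both sides vanish.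
  by_cases h0 : μ (W n) = 0
  · rw [Measure.restrict_eq_zero.2 h0]
    simp
  · rw [measureReal_def, mul_inv_cancel₀ (ENNReal.toReal_ne_zero.2 ⟨h0, measure_ne_top _ _⟩),
      one_mul]

theorem theorem3p6 {X : Type*} [MeasurableSpace X] [StandardBorelSpace X]
    (μ : Measure X) [IsProbabilityMeasure μ] [NullSingletonClass μ]
    (T : X ≃ᵐ X) (hT : Ergodic T μ)
    (f : X → ℝ) (hfm : Measurable f) (hf2 : MemLp f 2 μ) (hf : ∃ c > 0, ∀ x, c ≤ f x)
    (W : ℕ → Set X) (hW : ∀ n, MeasurableSet (W n))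
    (q q' : ℕ → ℕ) (a a' : ℕ → ℝ) (α : ℝ) (hα0 : 0 < α) (hα1 : α ≤ 1)
    (P : Measure (ℝ × ℝ)) [IsProbabilityMeasure P]
    (wl1 : Tendsto (fun n => μ.real (W n)) atTop (𝓝 α))
    (wl2 : Tendsto (fun n => μ (symmDiff (W n) (T ⁻¹' W n))) atTop (𝓝 0))
    (wl3 : IsRigiditySeqAlong μ T W q)
    (wl4 : IsRigiditySeqAlong μ T W q')
    (wl5 : ∃ D : ℝ, ∀ n, ∫ x in W n, |centred T f (q n) (a n) x| ^ 2 ∂μ ≤ D)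
    (wl6 : ∃ D : ℝ, ∀ n, ∫ x in W n, |centred T f (q' n) (a' n) x| ^ 2 ∂μ ≤ D)
    (wl7 : ∀ φ : ℝ × ℝ →ᵇ ℝ, Tendsto
      (fun n => ∫ z, φ z ∂((ProbabilityTheory.cond μ (W n)).map
        fun x => (centred T f (q' n) (a' n) x, centred T f (q n) (a n) x)))
      atTop (𝓝 (∫ z, φ z ∂P))) :
    -- every subsequence has a further subsequence converging in `J₃` to a limit of the stated form
    (∀ i : ℕ → ℕ, StrictMono i → ∃ j : ℕ → ℕ, StrictMono j ∧
      ∃ ν, IsJoining3 (specialFlow T f hf) (specialProb μ f) ν ∧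
        TendstoJoining3 (specialFlow T f hf) (specialProb μ f)
          (fun n => offDiagonal3 (specialFlow T f hf) (specialProb μ f)
            (a' (i (j n))) (a (i (j n))))
          (ENNReal.ofReal α • integralJoining3 (specialFlow T f hf) (specialProb μ f) P
            + ENNReal.ofReal (1 - α) • ν)) ∧
    -- every limit in `J₃` of the sequence, or of a subsequence, has the stated form
    (∀ i : ℕ → ℕ, StrictMono i → ∀ ρ,
      TendstoJoining3 (specialFlow T f hf) (specialProb μ f)
        (fun n => offDiagonal3 (specialFlow T f hf) (specialProb μ f) (a' (i n)) (a (i n))) ρ →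
      ∃ ν, IsJoining3 (specialFlow T f hf) (specialProb μ f) ν ∧
        ρ = ENNReal.ofReal α • integralJoining3 (specialFlow T f hf) (specialProb μ f) P
            + ENNReal.ofReal (1 - α) • ν) ∧
    -- for `α = 1` the whole sequence converges
    (α = 1 → TendstoJoining3 (specialFlow T f hf) (specialProb μ f)
      (fun n => offDiagonal3 (specialFlow T f hf) (specialProb μ f) (a' n) (a n))
      (integralJoining3 (specialFlow T f hf) (specialProb μ f) P)) := by
  have hfi : Integrable f μ := hf2.integrable one_le_two
  have hmp := hT.toMeasurePreserving
  have hm := isProbabilityMeasure_specialProb f hf hfm μ hfi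
  have hΦ := measurePreserving_specialFlow_specialProb T f hf hfm hmp
  have hcomm := specialFlow_comm T f hf
  have hJ := isJoining3_integralJoining3 (measurable_specialFlow_uncurry T f hf hfm) hΦ hcomm P
  have : StandardBorelSpace (specialSpace f) := (measurableSet_specialSpace f hfm).standardBorel
  have hbase : Measurable fun y : specialSpace f => y.1.1 :=
    measurable_fst.comp measurable_subtype_coe
  have hV : ∀ n, MeasurableSet {y : specialSpace f | y.1.1 ∈ W n} := fun n => hbase (hW n)
  have hlim := fun φ : ℝ × ℝ →ᵇ ℝ => tendsto_setIntegral_of_tendsto_cond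
    (fun n => (measurable_centred T f hfm (q' n) (a' n)).prodMk
      (measurable_centred T f hfm (q n) (a n))) wl1 φ (wl7 φ)
  have hσ := fun (A B C : Set (specialSpace f)) (hA : MeasurableSet A) (hB : MeasurableSet B)
    (hC : MeasurableSet C) => tendsto_offDiagonal3_restrict T f hf hT hfm hfi hW hα0.le hα1 wl2 wl3
      wl4 hlim hA hB hC
  -- The convergence over `W n` holds for the full sequence, so it can be restricted to any
  -- subsequence before compactness is invoked.
  have hsub := fun (i : ℕ → ℕ) (hi : StrictMono i) =>
    exists_subseq_tendstoJoining3_of_partial hΦ hcomm hJ (fun n => hV (i n)) hα0.le hα1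
      (t := fun n => a' (i n)) (u := fun n => a (i n)) fun A B C hA hB hC =>
        (hσ A B C hA hB hC).comp hi.tendsto_atTop
  refine ⟨hsub, fun i hi ρ hρ => ?_, fun h1 => ?_⟩
  · obtain ⟨j, hj, ν, hν, hlimν⟩ := hsub i hi
    -- Boxes determine the limit, so a given limit coincides with the one found along the further
    -- subsequence.
    exact ⟨ν, hν, (hρ.comp_strictMono hj).unique hlimν⟩
  · subst h1
    exact tendstoJoining3_of_partial_one hΦ hcomm hJ hV hσ
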